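/- **Theorem 2.** Let $L$ be the first-order language with the Boolean symbols $0,1,\cap,\cup,\neg$, unary predicates $C_n$ for all integers $n\ge 1$, and one further unary predicate $Fin$. Write $x\le y$ for $x\cap y=x$, $x<y$ for $x\le y\wedge x\neq y$, $x-y$ for $x\cap\neg y$, and (for $n\ge 0$) $\sharp(x)\le n$ for $\neg C_{n+1}(x)$. An atom is a nonzero element $a$ such that every $y\le a$ is $0$ or $a$. Let $T_2$ be the $L$-theory with the following axioms: 1. the axioms of Boolean algebras, the sentences saying that the algebra is infinite, and the sentence saying that every nonzero element has an atom below it; 2. for each $n\ge 1$, the defining axiom of $C_n$: for all $x$, $C_n(x)$ holds if and only if there are at least $n$ distinct atoms $\alpha\le x$; 3. $Fin$ is a proper ideal: $Fin(0)$, $\neg Fin(1)$, $Fin$ is closed under $\cup$, and $y\le x\wedge Fin(x)$ implies $Fin(y)$; 4. for each $n\ge 0$, $\forall x\,(\sharp(x)\le n\Rightarrow Fin(x))$; 5. (Main Axiom) $\forall x\,\bigl(\neg Fin(x)\Rightarrow \exists y\,(y<x\wedge\neg Fin(y)\wedge\neg Fin(x-y))\bigr)$. Then: * $T_2$ is complete,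 that is, it is consistent and for every $L$-sentence $\varphi$ either $T_2\models\varphi$ or $T_2\models\neg\varphi$; * $T_2$ is decidable: the set of Gödel numbers of the $L$-sentences $\varphi$ with $T_2\models\varphi$ is recursive; * $T_2$ has quantifier elimination in $L$: every $L$-formula is equivalent modulo $T_2$ to a quantifier-free $L$-formula in the same free variables; * for every infinite set $I$, $T_2$ axiomatizes the theory of the powerset algebra of $I$ with the finite sets distinguished: if $C_n(s)$ is interpreted as "there are at least $n$ distinct atoms below $s$" and $Fin(s)$ as "$s$ is finite", then an $L$-sentence is true in $Powerset(I)$ if and only if it is a consequence of $T_2$. -/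

import Mathlib

open FirstOrder

/-! First-order theory of infinite atomic Boolean algebras with a distinguished ideal `Fin`. -/

namespace BoolFin

/-- The Boolean function symbols `0, 1, ¬, ∩, ∪`. -/
inductive Func : ℕ → Type
  | bot : Func 0
  | top : Func 0
  | compl : Func 1
  | inf : Func 2
  | sup : Func 2

/-- The unary predicates: `C n` for each `n ≥ 1` ("at least `n` atoms below"), and `fin`. -/
inductive Rel : ℕ → Type
  | C (n : ℕ+) : Rel 1
  | fin : Rel 1

/-- The language `{0, 1, ∩, ∪, ¬} ∪ {C_n : n ≥ 1} ∪ {Fin}`. -/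
abbrev lang : FirstOrder.Language.{0, 0} := ⟨Func, Rel⟩

open FirstOrder.Language

section Formulas

variable {α : Type} {n : ℕ}

instance : Bot (lang.Term α) := ⟨Constants.term (L := lang) Func.bot⟩
instance : Top (lang.Term α) := ⟨Constants.term (L := lang) Func.top⟩
instance : Compl (lang.Term α) := ⟨Functions.apply₁ (L := lang) Func.compl⟩
instance : Min (lang.Term α) := ⟨Functions.apply₂ (L := lang) Func.inf⟩
instance : Max (lang.Term α) := ⟨Functions.apply₂ (L := lang) Func.sup⟩

/-- The formula `C_k(t)`. -/
def cF (k : ℕ+) (t : lang.Term (α ⊕ Fin n)) : lang.BoundedFormula α n :=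
  Relations.boundedFormula₁ (L := lang) (Rel.C k) t

/-- The formula `Fin(t)`. -/
def finF (t : lang.Term (α ⊕ Fin n)) : lang.BoundedFormula α n :=
  Relations.boundedFormula₁ (L := lang) Rel.fin t

/-- The formula `s ≤ t`, that is, `s ∩ t = s`. -/
def leF (s t : lang.Term (α ⊕ Fin n)) : lang.BoundedFormula α n := (s ⊓ t) =' s

/-- The term `t`, regarded in a context with one more bound variable. -/
def up (t : lang.Term (α ⊕ Fin n)) : lang.Term (α ⊕ Fin (n + 1)) :=
  t.relabel (Sum.map id Fin.castSucc)

/-- The formula "`t` is an atom": `t ≠ 0 ∧ ∀ y, y ≤ t → y = 0 ∨ y = t`. -/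
def atomF (t : lang.Term (α ⊕ Fin n)) : lang.BoundedFormula α n :=
  ∼(t =' ⊥) ⊓
    ∀' (leF (&(Fin.last n)) (up t) ⟹ ((&(Fin.last n) =' ⊥) ⊔ (&(Fin.last n) =' up t)))

/-- The formula in one free variable `x` saying that there are at least `k` distinct atoms
below `x`, written without the predicates `C_m`. -/
noncomputable def atLeastAtoms (k : ℕ) : lang.Formula (Fin 1) :=
  BoundedFormula.exs (n := k)
    (BoundedFormula.iInf (fun i : Fin k => atomF (&i) ⊓ leF (&i) (Term.var (Sum.inl 0))) ⊓
      BoundedFormula.iInf (fun p : {p : Fin k × Fin k // p.1 ≠ p.2} => ∼((&p.1.1) =' (&p.1.2))))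

end Formulas

section Axioms

/-- Axioms of Boolean algebras. -/
def booleanAxioms : lang.Theory :=
  { ∀' ∀' ((&0 ⊓ &1) =' (&1 ⊓ &0)),
    ∀' ∀' ((&0 ⊔ &1) =' (&1 ⊔ &0)),
    ∀' ∀' ∀' (((&0 ⊓ &1) ⊓ &2) =' (&0 ⊓ (&1 ⊓ &2))),
    ∀' ∀' ∀' (((&0 ⊔ &1) ⊔ &2) =' (&0 ⊔ (&1 ⊔ &2))),
    ∀' ∀' ((&0 ⊓ (&0 ⊔ &1)) =' &0),
    ∀' ∀' ((&0 ⊔ (&0 ⊓ &1)) =' &0),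
    ∀' ∀' ∀' ((&0 ⊓ (&1 ⊔ &2)) =' ((&0 ⊓ &1) ⊔ (&0 ⊓ &2))),
    ∀' ((&0 ⊓ ⊤) =' &0),
    ∀' ((&0 ⊔ ⊥) =' &0),
    ∀' ((&0 ⊓ (&0)ᶜ) =' ⊥),
    ∀' ((&0 ⊔ (&0)ᶜ) =' ⊤) }

/-- Every nonzero element has an atom below it. -/
def atomicAxiom : lang.Sentence :=
  ∀' (∼(&0 =' ⊥) ⟹ ∃' (atomF (&1) ⊓ leF (&1) (&0)))

/-- The defining axiom of `C_k`: `∀ x, C_k(x) ↔ there are at least k distinct atoms below x`. -/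
noncomputable def cAxiom (k : ℕ+) : lang.Sentence :=
  Formula.iAlls (Fin 1) (Formula.relabel (Sum.inr : Fin 1 → Empty ⊕ Fin 1)
    (BoundedFormula.iff (cF k (Term.var (Sum.inl 0))) (atLeastAtoms k)))

/-- The theory `T₁` of infinite atomic Boolean algebras, with the predicates `C_k`. -/
noncomputable def T₁ : lang.Theory :=
  booleanAxioms ∪ lang.infiniteTheory ∪ {atomicAxiom} ∪ Set.range cAxiom

/-- `Fin` is a proper ideal. -/
def idealAxioms : lang.Theory :=
  { finF ⊥,
    ∀' ∀' (finF (&0) ⊓ finF (&1) ⟹ finF (&0 ⊔ &1)),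
    ∀' ∀' (leF (&1) (&0) ⊓ finF (&0) ⟹ finF (&1)),
    ∼(finF ⊤) }

/-- `∀ x, ♯(x) ≤ k → Fin(x)`, where `♯(x) ≤ k` means `¬ C_{k+1}(x)`. -/
def smallAxiom (k : ℕ) : lang.Sentence :=
  ∀' (∼(cF k.succPNat (&0)) ⟹ finF (&0))

/-- `∀ x, ¬ Fin(x) → ∃ y, y < x ∧ ¬ Fin(y) ∧ ¬ Fin(x - y)`. -/
def mainAxiom : lang.Sentence :=
  ∀' (∼(finF (&0)) ⟹
    ∃' ((leF (&1) (&0) ⊓ ∼(&1 =' &0)) ⊓ ∼(finF (&1)) ⊓ ∼(finF (&0 ⊓ (&1)ᶜ))))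

/-- The theory `T₂`. -/
noncomputable def T₂ : lang.Theory :=
  T₁ ∪ idealAxioms ∪ Set.range smallAxiom ∪ {mainAxiom}

end Axioms

section Powerset

/-- The powerset of `I` as a structure: Boolean operations, `C_k(s)` iff there are at least `k`
distinct atoms of the powerset algebra below `s`, and `Fin(s)` iff `s` is finite. -/
instance powersetStructure (I : Type*) : lang.Structure (Set I) where
  funMap := fun {_} f v => match f, v with
    | Func.bot, _ => ∅
    | Func.top, _ => Set.univ
    | Func.compl, v => (v 0)ᶜ
    | Func.inf, v => v 0 ∩ v 1
    | Func.sup, v => v 0 ∪ v 1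
  RelMap := fun {_} r v => match r, v with
    | Rel.C k, v => ∃ A : Finset (Set I), A.card = k ∧ ∀ a ∈ A, IsAtom a ∧ a ⊆ v 0
    | Rel.fin, v => (v 0).Finite

end Powerset

section Decidability

/-- Gödel numbering of terms whose variables are bound variables. -/
def termCode {n : ℕ} : lang.Term (Empty ⊕ Fin n) → ℕ
  | .var (Sum.inl e) => e.elim
  | .var (Sum.inr i) => Nat.pair 0 i
  | .func Func.bot _ => Nat.pair 1 0
  | .func Func.top _ => Nat.pair 2 0
  | .func Func.compl ts => Nat.pair 3 (termCode (ts 0))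
  | .func Func.inf ts => Nat.pair 4 (Nat.pair (termCode (ts 0)) (termCode (ts 1)))
  | .func Func.sup ts => Nat.pair 5 (Nat.pair (termCode (ts 0)) (termCode (ts 1)))

/-- Gödel numbering of formulas without free variables other than the `n` bound variables in scope;
for `n = 0` these are the sentences. -/
def code : {n : ℕ} → lang.BoundedFormula Empty n → ℕ
  | _, .falsum => Nat.pair 0 0
  | _, .equal s t => Nat.pair 1 (Nat.pair (termCode s) (termCode t))
  | _, .rel (Rel.C k) ts => Nat.pair 2 (Nat.pair k (termCode (ts 0)))
  | _, .rel Rel.fin ts => Nat.pair 3 (termCode (ts 0))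
  | _, .imp φ ψ => Nat.pair 4 (Nat.pair (code φ) (code ψ))
  | _, .all φ => Nat.pair 5 (code φ)

theorem termCode_injective {n : ℕ} : Function.Injective (termCode (n := n)) := by
  intro s
  induction s with
  | var a =>
    intro t h
    rcases a with e | i
    · exact e.elim
    · rcases t with (e | j) | ⟨g, us⟩
      · exact e.elim
      · simpa [termCode, Fin.ext_iff] using h
      · cases g <;> simp [termCode] at h
  | func f ts ih =>
    intro t h
    rcases t with (e | j) | ⟨g, us⟩
    · exact e.elim
    · cases f <;> simp [termCode] at h
    · cases f <;> cases g <;> simp [termCode] at h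
      · congr 1; exact funext fun i => i.elim0
      · congr 1; exact funext fun i => i.elim0
      · congr 1; funext i; fin_cases i; exact ih 0 h
      · congr 1; funext i; fin_cases i
        · exact ih 0 h.1
        · exact ih 1 h.2
      · congr 1; funext i; fin_cases i
        · exact ih 0 h.1
        · exact ih 1 h.2

theorem code_injective {n : ℕ} : Function.Injective (code (n := n)) := by
  intro φ
  induction φ with
  | falsum =>
    intro ψ h
    cases ψ with
    | rel r us => cases r <;> simp [code] at h
    | _ => simp_all [code]
  | equal s t =>
    intro ψ h
    cases ψ with
    | rel r us => cases r <;> simp [code] at h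
    | equal s' t' =>
      simp only [code, Nat.pair_eq_pair, true_and] at h
      rw [termCode_injective h.1, termCode_injective h.2]
    | _ => simp [code] at h
  | rel r ts =>
    intro ψ h
    cases ψ with
    | rel r' us =>
      cases r <;> cases r' <;> simp [code] at h
      · obtain ⟨h1, h2⟩ := h
        subst h1
        congr 1; funext i; fin_cases i; exact termCode_injective h2
      · congr 1; funext i; fin_cases i; exact termCode_injective h
    | _ => cases r <;> simp [code] at h
  | imp φ₁ φ₂ ih₁ ih₂ =>
    intro ψ h
    cases ψ with
    | rel r us => cases r <;> simp [code] at h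
    | imp ψ₁ ψ₂ =>
      simp only [code, Nat.pair_eq_pair, true_and] at h
      rw [ih₁ h.1, ih₂ h.2]
    | _ => simp [code] at h
  | all φ ih =>
    intro ψ h
    cases ψ with
    | rel r us => cases r <;> simp [code] at h
    | all ψ =>
      simp only [code, Nat.pair_eq_pair, true_and] at h
      rw [ih h]
    | _ => simp [code] at h

/-- A theory is decidable if the set of Gödel numbers of its consequences is recursive. -/
def IsDecidable (T : lang.Theory) : Prop :=
  ComputablePred fun m : ℕ => ∃ φ : lang.Sentence, code φ = m ∧ T ⊨ᵇ φ

end Decidability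

/-- `T` has quantifier elimination: modulo `T`, every formula is equivalent to a quantifier-free
formula in the same free variables. -/
def HasQuantifierElimination (T : lang.Theory) : Prop :=
  ∀ (n : ℕ) (φ : lang.Formula (Fin n)),
    ∃ ψ : lang.Formula (Fin n), BoundedFormula.IsQF ψ ∧ T ⊨ᵇ φ.iff ψ

end BoolFin

/-!
To a tuple `a` in a model belongs the partition into the Boolean combinations of its entries, the
cells. The truth of a formula at `a` depends only on which cells are in `Fin` and on the number of
atoms below each cell, up to a bound computable from the formula. For atomic formulas this holds
because every value of a term is a union of cells. For a quantifier one needs that cutting the cells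
by a further element is a back-and-forth step: an element outside `Fin` splits into two parts
outside `Fin` by the Main Axiom, and into `i` atoms and a rest outside `Fin` for each `i`; an
element of `Fin` splits in every way compatible with the number of its atoms, where a bound of
`2 * m` before the cut determines the splittings up to the bound `m`. Finitely many possibilities
for the counts occur, so the recursion on the formula is a primitive recursive evaluation of its
truth.

A sentence is evaluated at the empty tuple, whose only cell `⊤` is outside `Fin`; hence all models
agree, which gives completeness, decidability and the theory of the powersets. The counts of the
cells are expressed by quantifier-free formulas, which gives quantifier elimination.
-/

namespace BoolFin

open FirstOrder.Language

/-! ### The models of `T₂` -/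

/-- The Boolean symbols of `lang` are interpreted by the given operations. No laws are required,
so that terms can be evaluated in a structure that is not yet known to be a Boolean algebra. -/
class IsBooleanStructure (A : Type*) [Bot A] [Top A] [Compl A] [Min A] [Max A]
    [lang.Structure A] : Prop where
  funMap_bot (v : Fin 0 → A) : Structure.funMap (L := lang) Func.bot v = ⊥
  funMap_top (v : Fin 0 → A) : Structure.funMap (L := lang) Func.top v = ⊤
  funMap_compl (v : Fin 1 → A) : Structure.funMap (L := lang) Func.compl v = (v 0)ᶜ
  funMap_inf (v : Fin 2 → A) : Structure.funMap (L := lang) Func.inf v = v 0 ⊓ v 1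
  funMap_sup (v : Fin 2 → A) : Structure.funMap (L := lang) Func.sup v = v 0 ⊔ v 1

/-- The interpretation of the predicate `Fin`. -/
def IsFin {M : Type*} [lang.Structure M] (x : M) : Prop :=
  Structure.RelMap (L := lang) Rel.fin ![x]

/-- The number `♯(x)` of atoms below `x`. -/
noncomputable def size {A : Type*} [BooleanAlgebra A] (x : A) : ℕ∞ := {a | IsAtom a ∧ a ≤ x}.encard

/-- The algebraic form of a model of `T₂`: an atomic Boolean algebra with a proper ideal
`IsFin` that contains all elements above finitely many atoms, and such that every element outside
the ideal splits into two elements outside the ideal. -/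
class FinAlgebra (A : Type*) [BooleanAlgebra A] [lang.Structure A] : Prop
    extends IsBooleanStructure A, IsAtomic A where
  relMap_C (k : ℕ+) (v : Fin 1 → A) :
    Structure.RelMap (L := lang) (Rel.C k) v ↔ ((k : ℕ) : ℕ∞) ≤ size (v 0)
  isFin_bot : IsFin (⊥ : A)
  isFin_sup (x y : A) : IsFin x → IsFin y → IsFin (x ⊔ y)
  isFin_of_le (x y : A) : y ≤ x → IsFin x → IsFin y
  not_isFin_top : ¬ IsFin (⊤ : A)
  isFin_of_size_ne_top (x : A) : size x ≠ ⊤ → IsFin x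
  exists_split (x : A) : ¬ IsFin x → ∃ y ≤ x, ¬ IsFin y ∧ ¬ IsFin (x ⊓ yᶜ)

section Realize

variable {α : Type} {n : ℕ} {A : Type*} [lang.Structure A]

@[simp] theorem realize_up (t : lang.Term (α ⊕ Fin n)) (v : α → A) (xs : Fin n → A) (x : A) :
    (up t).realize (Sum.elim v (Fin.snoc xs x)) = t.realize (Sum.elim v xs) := by
  simp [up, Term.realize_relabel, Function.comp_def, Sum.elim_map]

@[simp] theorem realize_cF (k : ℕ+) (t : lang.Term (α ⊕ Fin n)) (v : α → A) (xs : Fin n → A) :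
    (cF k t).Realize v xs ↔
      Structure.RelMap (L := lang) (Rel.C k) ![t.realize (Sum.elim v xs)] :=
  BoundedFormula.realize_rel₁

@[simp] theorem realize_finF (t : lang.Term (α ⊕ Fin n)) (v : α → A) (xs : Fin n → A) :
    (finF t).Realize v xs ↔ IsFin (t.realize (Sum.elim v xs)) :=
  BoundedFormula.realize_rel₁

section Operations

variable [Bot A] [Top A] [Compl A] [Min A] [Max A] [IsBooleanStructure A]

@[simp] theorem realize_bot (v : α → A) : (⊥ : lang.Term α).realize v = ⊥ :=
  IsBooleanStructure.funMap_bot _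

@[simp] theorem realize_top (v : α → A) : (⊤ : lang.Term α).realize v = ⊤ :=
  IsBooleanStructure.funMap_top _

@[simp] theorem realize_compl (v : α → A) (t : lang.Term α) : tᶜ.realize v = (t.realize v)ᶜ :=
  IsBooleanStructure.funMap_compl _

@[simp] theorem realize_inf (v : α → A) (s t : lang.Term α) :
    (s ⊓ t).realize v = s.realize v ⊓ t.realize v :=
  IsBooleanStructure.funMap_inf _

@[simp] theorem realize_sup (v : α → A) (s t : lang.Term α) :
    (s ⊔ t).realize v = s.realize v ⊔ t.realize v :=
  IsBooleanStructure.funMap_sup _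

end Operations

variable [BooleanAlgebra A] [IsBooleanStructure A]

@[simp] theorem realize_leF (s t : lang.Term (α ⊕ Fin n)) (v : α → A) (xs : Fin n → A) :
    (leF s t).Realize v xs ↔ s.realize (Sum.elim v xs) ≤ t.realize (Sum.elim v xs) := by
  rw [leF, BoundedFormula.realize_bdEqual, realize_inf, inf_eq_left]

@[simp] theorem realize_atomF (t : lang.Term (α ⊕ Fin n)) (v : α → A) (xs : Fin n → A) :
    (atomF t).Realize v xs ↔ IsAtom (t.realize (Sum.elim v xs)) := by
  simp only [atomF, BoundedFormula.realize_inf, BoundedFormula.realize_not,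
    BoundedFormula.realize_bdEqual, realize_bot, BoundedFormula.realize_all,
    BoundedFormula.realize_imp, BoundedFormula.realize_sup, realize_leF, realize_up,
    Function.comp_apply, Term.realize_var, Sum.elim_inr, Fin.snoc_last]
  exact ⟨fun ⟨h0, h⟩ => ⟨h0, fun b hb => (h b hb.le).resolve_right hb.ne⟩,
    fun h => ⟨h.1, fun b hb => h.le_iff.1 hb⟩⟩

theorem natCast_le_encard_iff_exists_finset {β : Type*} {s : Set β} {k : ℕ} :
    (k : ℕ∞) ≤ s.encard ↔ ∃ t : Finset β, t.card = k ∧ ∀ b ∈ t, b ∈ s := by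
  constructor
  · intro h
    obtain ⟨t, hts, ht⟩ := Set.exists_subset_encard_eq h
    obtain ⟨t, rfl⟩ := (Set.finite_of_encard_eq_coe ht).exists_finset_coe
    exact ⟨t, by simpa using ht, hts⟩
  · rintro ⟨t, rfl, hts⟩
    rw [← Set.encard_coe_eq_coe_finsetCard]
    exact Set.encard_le_encard hts

theorem natCast_le_encard_iff_exists_injective {β : Type*} {s : Set β} {k : ℕ} :
    (k : ℕ∞) ≤ s.encard ↔ ∃ f : Fin k → β, (∀ i, f i ∈ s) ∧ Function.Injective f := by
  rw [natCast_le_encard_iff_exists_finset]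
  constructor
  · rintro ⟨t, ht, hts⟩
    exact ⟨fun i => (t.equivFinOfCardEq ht).symm i, fun i => hts _ (Subtype.prop _),
      Subtype.val_injective.comp (Equiv.injective _)⟩
  · rintro ⟨f, hf, hinj⟩
    exact ⟨Finset.univ.map ⟨f, hinj⟩, by simp, by simpa using hf⟩

theorem realize_atLeastAtoms (k : ℕ) (v : Fin 1 → A) :
    (atLeastAtoms k).Realize v ↔ (k : ℕ∞) ≤ size (v 0) := by
  rw [size, natCast_le_encard_iff_exists_injective, atLeastAtoms, BoundedFormula.realize_exs]
  simp only [BoundedFormula.realize_inf, BoundedFormula.realize_iInf, realize_leF, realize_atomF,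
    BoundedFormula.realize_not, BoundedFormula.realize_bdEqual, Term.realize_var, Sum.elim_inl,
    Sum.elim_inr, Function.comp_apply, Subtype.forall, Prod.forall, Set.mem_ofPred_eq,
    Function.Injective, not_imp_not]

end Realize

section Axioms

theorem exists_isBooleanStructure {M : Type*} [lang.Structure M] (h : M ⊨ booleanAxioms) :
    ∃ _ : BooleanAlgebra M, IsBooleanStructure M := by
  let _ : Bot M := ⟨Structure.funMap (L := lang) Func.bot ![]⟩
  let _ : Top M := ⟨Structure.funMap (L := lang) Func.top ![]⟩
  let _ : Compl M := ⟨fun a => Structure.funMap (L := lang) Func.compl ![a]⟩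
  let _ : Min M := ⟨fun a b => Structure.funMap (L := lang) Func.inf ![a, b]⟩
  let _ : Max M := ⟨fun a b => Structure.funMap (L := lang) Func.sup ![a, b]⟩
  have hM : IsBooleanStructure M :=
    { funMap_bot := fun v => congrArg _ (Subsingleton.elim _ _)
      funMap_top := fun v => congrArg _ (Subsingleton.elim _ _)
      funMap_compl := fun v => congrArg _ (List.ofFn_injective rfl)
      funMap_inf := fun v => congrArg _ (List.ofFn_injective rfl)
      funMap_sup := fun v => congrArg _ (List.ofFn_injective rfl) }
  simp only [Theory.model_iff, booleanAxioms, Set.mem_insert_iff, Set.mem_singleton_iff,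
    forall_eq_or_imp, forall_eq, Sentence.Realize, Formula.Realize, BoundedFormula.realize_all,
    BoundedFormula.realize_bdEqual, realize_bot, realize_top, realize_compl, realize_inf,
    realize_sup, Function.comp_apply, Term.realize_var, Sum.elim_inr] at h
  obtain ⟨inf_comm, sup_comm, inf_assoc, sup_assoc, inf_sup_self, sup_inf_self, inf_sup,
    inf_top, sup_bot, inf_compl, sup_compl⟩ := h
  let _ : Lattice M := Lattice.mk' sup_comm sup_assoc inf_comm inf_assoc sup_inf_self inf_sup_self
  exact ⟨{ DistribLattice.ofInfSupLe fun a b c => (inf_sup a b c).le with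
    inf_compl_le_bot := fun a => (inf_compl a).le
    top_le_sup_compl := fun a => (sup_compl a).ge
    le_top := fun a => inf_eq_left.1 (inf_top a)
    bot_le := fun a => sup_eq_left.1 (sup_bot a) }, { hM with }⟩

theorem models_smallAxiom_iff {M : Type*} [lang.Structure M] (k : ℕ) : M ⊨ smallAxiom k ↔
    ∀ x : M, ¬ Structure.RelMap (L := lang) (Rel.C k.succPNat) ![x] → IsFin x := by
  simp [smallAxiom, Sentence.Realize, Formula.Realize, Fin.snoc]

theorem models_range_iff {M ι : Type*} [lang.Structure M] (φ : ι → lang.Sentence) :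
    M ⊨ Set.range φ ↔ ∀ i, M ⊨ φ i := by
  rw [Theory.model_iff, Set.forall_mem_range]

variable {A : Type*} [BooleanAlgebra A] [lang.Structure A] [IsBooleanStructure A]

theorem models_booleanAxioms : A ⊨ booleanAxioms := by
  simp only [Theory.model_iff, booleanAxioms, Set.mem_insert_iff, Set.mem_singleton_iff,
    forall_eq_or_imp, forall_eq, Sentence.Realize, Formula.Realize, BoundedFormula.realize_all,
    BoundedFormula.realize_bdEqual, realize_bot, realize_top, realize_compl, realize_inf,
    realize_sup, Function.comp_apply, Term.realize_var, Sum.elim_inr, inf_sup_self, sup_inf_self,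
    inf_top_eq, sup_bot_eq, inf_compl_self, sup_compl_eq_top, implies_true, true_and,
    and_true]
  exact ⟨fun _ _ => inf_comm _ _, fun _ _ => sup_comm _ _, fun _ _ _ => inf_assoc _ _ _,
    fun _ _ _ => sup_assoc _ _ _, fun _ _ _ => inf_sup_left _ _ _⟩

theorem models_atomicAxiom_iff : A ⊨ atomicAxiom ↔ IsAtomic A := by
  simp [atomicAxiom, Sentence.Realize, Formula.Realize, Fin.snoc, isAtomic_iff,
    or_iff_not_imp_left]

theorem models_cAxiom_iff (k : ℕ+) : A ⊨ cAxiom k ↔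
    ∀ v : Fin 1 → A, Structure.RelMap (L := lang) (Rel.C k) v ↔ ((k : ℕ) : ℕ∞) ≤ size (v 0) := by
  rw [cAxiom, Sentence.Realize, Formula.realize_iAlls]
  refine forall_congr' fun v => ?_
  rw [Formula.realize_relabel, Formula.realize_iff]
  refine iff_congr ((realize_cF k _ _ _).trans (iff_of_eq (congrArg _ ?_)))
    (realize_atLeastAtoms k v)
  exact List.ofFn_injective rfl

theorem models_idealAxioms_iff : A ⊨ idealAxioms ↔
    IsFin (⊥ : A) ∧ (∀ x y : A, IsFin x → IsFin y → IsFin (x ⊔ y)) ∧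
      (∀ x y : A, y ≤ x → IsFin x → IsFin y) ∧ ¬ IsFin (⊤ : A) := by
  simp [Theory.model_iff, idealAxioms, Sentence.Realize, Formula.Realize, Fin.snoc]

theorem models_mainAxiom_iff : A ⊨ mainAxiom ↔
    ∀ x : A, ¬ IsFin x → ∃ y, ((y ≤ x ∧ y ≠ x) ∧ ¬ IsFin y) ∧ ¬ IsFin (x ⊓ yᶜ) := by
  simp [mainAxiom, Sentence.Realize, Formula.Realize, Fin.snoc]

theorem models_T₂_iff : A ⊨ T₂ ↔ FinAlgebra A := by
  simp only [T₂, T₁, Theory.model_union_iff, Theory.model_singleton_iff, models_booleanAxioms,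
    model_infiniteTheory_iff, models_atomicAxiom_iff, models_idealAxioms_iff, models_mainAxiom_iff,
    models_range_iff, models_cAxiom_iff, models_smallAxiom_iff, true_and]
  constructor
  · rintro ⟨⟨⟨⟨⟨_, hatomic⟩, hC⟩, hbot, hsup, hle, htop⟩, hsmall⟩, hmain⟩
    refine ⟨hC, hbot, hsup, hle, htop, fun x hx => ?_, fun x hx => ?_⟩
    · obtain ⟨k, hk⟩ := ENat.ne_top_iff_exists.1 hx
      refine hsmall k x fun h => ?_
      have : ((k + 1 : ℕ) : ℕ∞) ≤ k := hk ▸ (hC _ _).1 h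
      exact absurd (Nat.cast_le.1 this) (Nat.not_succ_le_self k)
    · obtain ⟨y, ⟨⟨hyx, -⟩, hy⟩, hxy⟩ := hmain x hx
      exact ⟨y, hyx, hy, hxy⟩
  · intro h
    have hinf : size (⊤ : A) = ⊤ :=
      not_not.1 fun hne => h.not_isFin_top (h.isFin_of_size_ne_top _ hne)
    refine ⟨⟨⟨⟨⟨?_, h.toIsAtomic⟩, h.relMap_C⟩, h.isFin_bot, h.isFin_sup, h.isFin_of_le,
      h.not_isFin_top⟩, fun k x hx => ?_⟩, fun x hx => ?_⟩
    · exact Set.infinite_univ_iff.1 ((Set.encard_eq_top_iff.1 hinf).mono (Set.subset_univ _))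
    · refine h.isFin_of_size_ne_top x fun htop => hx ((h.relMap_C _ _).2 ?_)
      exact le_top.trans_eq htop.symm
    · obtain ⟨y, hyx, hy, hxy⟩ := h.exists_split x hx
      refine ⟨y, ⟨⟨hyx, ?_⟩, hy⟩, hxy⟩
      rintro rfl
      exact hxy (inf_compl_self y ▸ h.isFin_bot)

theorem exists_finAlgebra (M : Type*) [lang.Structure M] [h : M ⊨ T₂] :
    ∃ _ : BooleanAlgebra M, FinAlgebra M := by
  have hB : M ⊨ booleanAxioms := h.mono fun φ hφ => .inl (.inl (.inl (.inl (.inl (.inl hφ)))))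
  obtain ⟨ba, hM⟩ := exists_isBooleanStructure hB
  exact ⟨ba, models_T₂_iff.1 h⟩

end Axioms

section Powerset

theorem size_set {I : Type*} (s : Set I) : size s = s.encard := by
  have h : {a | IsAtom a ∧ a ≤ s} = (fun i => ({i} : Set I)) '' s := by
    ext a
    constructor
    · rintro ⟨ha, has⟩
      obtain ⟨i, rfl⟩ := Set.isAtom_iff.1 ha
      exact ⟨i, Set.singleton_subset_iff.1 has, rfl⟩
    · rintro ⟨i, hi, rfl⟩
      exact ⟨Set.isAtom_singleton i, Set.singleton_subset_iff.2 hi⟩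
  rw [size, h, Set.singleton_injective.encard_image]

theorem exists_infinite_split {I : Type*} {s : Set I} (hs : s.Infinite) :
    ∃ t ⊆ s, t.Infinite ∧ (s ∩ tᶜ).Infinite := by
  obtain ⟨t, u, rfl, hd, hc⟩ := hs.exists_union_disjoint_cardinal_eq_of_infinite
  obtain ⟨e⟩ := Cardinal.eq.1 hc
  have htu : t.Infinite ↔ u.Infinite := e.finite_iff.not
  have ht : t.Infinite := (Set.infinite_union.1 hs).elim id htu.2
  refine ⟨t, Set.subset_union_left, ht, (htu.1 ht).mono fun i hi => ?_⟩
  exact ⟨.inr hi, hd.symm.notMem_of_mem_left hi⟩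

instance powerset_finAlgebra (I : Type*) [Infinite I] : FinAlgebra (Set I) where
  funMap_bot _ := rfl
  funMap_top _ := rfl
  funMap_compl _ := rfl
  funMap_inf _ := rfl
  funMap_sup _ := rfl
  relMap_C _ _ := natCast_le_encard_iff_exists_finset.symm
  isFin_bot := Set.finite_empty
  isFin_sup _ _ hx hy := Set.Finite.union hx hy
  isFin_of_le _ _ h hx := Set.Finite.subset hx h
  not_isFin_top := Set.infinite_univ
  isFin_of_size_ne_top x hx := Set.encard_ne_top_iff.1 (size_set x ▸ hx)
  exists_split _ hx := exists_infinite_split hx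

end Powerset

/-! ### Counting atoms -/

section Size

theorem supPrime_of_isAtom {A : Type*} [DistribLattice A] [OrderBot A] {p : A} (hp : IsAtom p) :
    SupPrime p :=
  supPrime_iff_supIrred.2 ⟨fun h => hp.1 (isMin_iff_eq_bot.1 h), fun x y hxy => by
    rcases hp.le_iff.1 (hxy ▸ le_sup_left : x ≤ p) with rfl | hx
    exacts [.inr (bot_sup_eq y ▸ hxy), .inl hx]⟩

section BooleanAlgebra

variable {A : Type*} [BooleanAlgebra A]

theorem size_sup {x y : A} (h : Disjoint x y) : size (x ⊔ y) = size x + size y := by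
  rw [size, size, size, ← Set.encard_union_eq]
  · congr 1
    ext p
    simp only [Set.mem_ofPred_eq, Set.mem_union, ← and_or_left]
    exact and_congr_right fun hp => (supPrime_of_isAtom hp).le_sup
  · exact Set.disjoint_left.2 fun p hx hy => hx.1.ne_bot (le_bot_iff.1 (h hx.2 hy.2))

theorem size_inf_add_size_inf_compl (x y : A) : size (x ⊓ y) + size (x ⊓ yᶜ) = size x := by
  rw [← size_sup (disjoint_compl_right.mono inf_le_right inf_le_right), ← inf_sup_left,
    sup_compl_eq_top, inf_top_eq]

theorem exists_le_size_eq {x : A} {n : ℕ} (h : n ≤ size x) : ∃ y ≤ x, size y = n := by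
  obtain ⟨s, rfl, hs⟩ := natCast_le_encard_iff_exists_finset.1 h
  refine ⟨s.sup id, Finset.sup_le fun a ha => (hs a ha).2, ?_⟩
  rw [← Set.encard_coe_eq_coe_finsetCard, size]
  congr 1
  ext p
  constructor
  · rintro ⟨hp, hle⟩
    obtain ⟨a, ha, hpa⟩ := (supPrime_of_isAtom hp).le_finset_sup.1 hle
    rwa [((hs a ha).1.le_iff.1 hpa).resolve_left hp.ne_bot]
  · exact fun hp => ⟨(hs p hp).1, Finset.le_sup (f := id) hp⟩

theorem exists_size_inf_eq {x : A} {p q : ℕ∞} (h : p + q = size x) (hpq : p ≠ ⊤ ∨ q ≠ ⊤) :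
    ∃ y, size (x ⊓ y) = p ∧ size (x ⊓ yᶜ) = q := by
  wlog hp : p ≠ ⊤ generalizing p q
  · obtain ⟨y, hyq, hyp⟩ := this (add_comm p q ▸ h) hpq.symm (hpq.resolve_left hp)
    exact ⟨yᶜ, hyp, by rwa [compl_compl]⟩
  lift p to ℕ using hp
  obtain ⟨y, hyx, hy⟩ := exists_le_size_eq (h ▸ le_self_add)
  rw [← inf_eq_right.2 hyx] at hy
  refine ⟨y, hy, ?_⟩
  rw [← size_inf_add_size_inf_compl x y, hy] at h
  exact (ENat.addLECancellable_natCast p).inj.1 h.symm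

theorem size_eq_zero_iff [IsAtomic A] {x : A} : size x = 0 ↔ x = ⊥ := by
  rw [size, Set.encard_eq_zero, Set.eq_empty_iff_forall_notMem]
  refine ⟨fun h => (eq_bot_or_exists_atom_le x).resolve_right fun ⟨a, ha⟩ => h a ha, ?_⟩
  rintro rfl a ⟨ha, hle⟩
  exact ha.ne_bot (le_bot_iff.1 hle)

end BooleanAlgebra

variable {A : Type*} [BooleanAlgebra A] [lang.Structure A] [FinAlgebra A]

theorem size_eq_top_of_not_isFin {x : A} (hx : ¬ IsFin x) : size x = ⊤ :=
  not_not.1 fun h => hx (FinAlgebra.isFin_of_size_ne_top x h)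

theorem isFin_sup_iff {x y : A} : IsFin (x ⊔ y) ↔ IsFin x ∧ IsFin y :=
  ⟨fun h => ⟨FinAlgebra.isFin_of_le _ _ le_sup_left h, FinAlgebra.isFin_of_le _ _ le_sup_right h⟩,
    fun h => FinAlgebra.isFin_sup _ _ h.1 h.2⟩

theorem isFin_inf_and_isFin_inf_compl (x y : A) :
    IsFin (x ⊓ y) ∧ IsFin (x ⊓ yᶜ) ↔ IsFin x := by
  rw [← isFin_sup_iff, ← inf_sup_left, sup_compl_eq_top, inf_top_eq]

end Size

section Truncation

theorem ne_top_of_add_eq_natCast {p q : ℕ∞} {n : ℕ} (h : p + q = n) : p ≠ ⊤ ∧ q ≠ ⊤ := by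
  rw [← not_or, ← ENat.add_eq_top, h]
  exact ENat.natCast_ne_top n

theorem exists_add_eq_of_min_eq {m : ℕ} {p q s : ℕ∞}
    (h : min (p + q) (2 * m : ℕ) = min s (2 * m : ℕ)) :
    ∃ p' q', p' + q' = s ∧ (p' ≠ ⊤ ∨ q' ≠ ⊤) ∧ min p' m = min p m ∧ min q' m = min q m := by
  rcases lt_or_ge (p + q) (2 * m : ℕ) with hlt | hge
  · refine ⟨p, q, ?_, .inl ?_, rfl, rfl⟩
    · rw [min_eq_left hlt.le] at h
      exact h.trans (min_eq_left (not_lt.1 fun hs => hlt.not_ge (h.trans (min_eq_right hs.le)).ge))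
    · exact (le_self_add.trans_lt (hlt.trans_le le_top)).ne
  · have hs : (2 * m : ℕ) ≤ s := by rw [min_eq_right hge] at h; exact min_eq_right_iff.1 h.symm
    wlog hq : (m : ℕ∞) ≤ q generalizing p q
    · have hp : (m : ℕ∞) ≤ p := by
        by_contra hp
        rw [not_le] at hp hq
        refine hge.not_gt ?_
        lift p to ℕ using hp.ne_top
        lift q to ℕ using hq.ne_top
        norm_cast at *
        omega
      obtain ⟨q', p', hsum, hne, hq', hp'⟩ := this (add_comm p q ▸ h) (add_comm p q ▸ hge) hp
      exact ⟨p', q', add_comm q' p' ▸ hsum, hne.symm, hp', hq'⟩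
    · obtain ⟨i, hi⟩ := ENat.ne_top_iff_exists.1
        ((min_le_right p m).trans_lt (ENat.natCast_lt_top m)).ne
      have him : i ≤ m := Nat.cast_le.1 (hi.trans_le (min_le_right p m))
      obtain ⟨r, rfl⟩ := exists_add_of_le ((Nat.cast_le.2 (by omega : m + i ≤ 2 * m)).trans hs)
      refine ⟨i, m + r, by push_cast; ring, .inl (ENat.natCast_ne_top i), ?_, ?_⟩
      · rw [← hi, min_eq_left (Nat.cast_le.2 him)]
      · rw [min_eq_right hq, min_eq_right le_self_add]

end Truncation

/-! ### Counts with bounded precision -/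

/-- `r` is an admissible value for the number of atoms below `x`, known only up to the bound `m`;
the value `⊤` is reserved for the elements that are not `Fin`, so that an element of `Fin` above
infinitely many atoms is counted by natural numbers `r ≥ m`. -/
structure IsCount {A : Type*} [BooleanAlgebra A] [lang.Structure A] (m : ℕ) (x : A) (r : ℕ∞) :
    Prop where
  isFin_iff : IsFin x ↔ r ≠ ⊤
  min_size : min (size x) m = min r m

/-- The pairs of counts up to `m` into which an element can split whose count up to `2 * m`
is `r`. -/
def splits (m : ℕ) (r : ℕ∞) : List (ℕ∞ × ℕ∞) :=
  if r = ⊤ then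
    (⊤, ⊤) :: (List.range (m + 1)).flatMap fun i : ℕ => [((i : ℕ∞), ⊤), (⊤, (i : ℕ∞))]
  else
    (List.Nat.antidiagonal r.toNat).map fun ij => ((ij.1 : ℕ∞), (ij.2 : ℕ∞))

theorem mem_splits_top {m : ℕ} {s : ℕ∞ × ℕ∞} :
    s ∈ splits m ⊤ ↔ s = (⊤, ⊤) ∨ ∃ i ≤ m, s = (↑i, ⊤) ∨ s = (⊤, ↑i) := by
  simp only [splits, if_true, List.mem_cons, List.mem_flatMap, List.mem_range, List.not_mem_nil,
    or_false, Nat.lt_succ_iff]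

theorem mem_splits_natCast {m n : ℕ} {s : ℕ∞ × ℕ∞} : s ∈ splits m n ↔ s.1 + s.2 = n := by
  simp only [splits, ENat.natCast_ne_top, if_false, ENat.toNat_natCast, List.mem_map,
    List.Nat.mem_antidiagonal, Prod.exists]
  constructor
  · rintro ⟨i, j, rfl, rfl⟩
    exact (Nat.cast_add i j).symm
  · rcases s with ⟨p, q⟩
    intro (h : p + q = n)
    obtain ⟨hp, hq⟩ := ne_top_of_add_eq_natCast h
    lift p to ℕ using hp
    lift q to ℕ using hq
    exact ⟨p, q, by exact_mod_cast h, rfl⟩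

namespace IsCount

variable {A : Type*} [BooleanAlgebra A] [lang.Structure A] {m : ℕ} {x y : A} {p q r : ℕ∞}

theorem mono {m' : ℕ} (h : IsCount m x r) (hm : m' ≤ m) : IsCount m' x r where
  isFin_iff := h.isFin_iff
  min_size := by
    have hm' : (m' : ℕ∞) ≤ m := Nat.cast_le.2 hm
    rw [← min_eq_right hm', ← min_assoc, h.min_size, min_assoc]

theorem natCast_le_size_iff {k : ℕ} (h : IsCount m x r) (hk : k ≤ m) : k ≤ size x ↔ k ≤ r := by
  have hk' : (k : ℕ∞) ≤ m := Nat.cast_le.2 hk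
  rw [← and_iff_left (a := (k : ℕ∞) ≤ size x) hk', ← le_min_iff, h.min_size, le_min_iff,
    and_iff_left hk']

theorem eq_bot_iff [IsAtomic A] (h : IsCount m x r) (hm : 1 ≤ m) : x = ⊥ ↔ r = 0 := by
  have h1 := h.natCast_le_size_iff hm
  rw [Nat.cast_one, Order.one_le_iff_ne_zero, Order.one_le_iff_ne_zero] at h1
  rw [← size_eq_zero_iff, not_iff_not.1 h1]

variable [FinAlgebra A]

theorem bot (m : ℕ) : IsCount m (⊥ : A) 0 :=
  ⟨iff_of_true FinAlgebra.isFin_bot ENat.zero_ne_top, by rw [size_eq_zero_iff.2 rfl]⟩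

theorem of_size_eq {n : ℕ} (h : size x = n) : IsCount m x n :=
  ⟨iff_of_true (FinAlgebra.isFin_of_size_ne_top x (h ▸ ENat.natCast_ne_top n))
    (ENat.natCast_ne_top n), by rw [h]⟩

theorem top_of_not_isFin (h : ¬ IsFin x) : IsCount m x ⊤ :=
  ⟨iff_of_false h (not_not.2 rfl), by rw [size_eq_top_of_not_isFin h]⟩

theorem sup (hxy : Disjoint x y) (hx : IsCount m x p) (hy : IsCount m y q) :
    IsCount m (x ⊔ y) (p + q) where
  isFin_iff := by
    rw [isFin_sup_iff, hx.isFin_iff, hy.isFin_iff, ← not_or, ← ENat.add_eq_top]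
  min_size := by
    have min_add (a b : ℕ∞) : min (a + b) m = min (min a m + min b m) m := by
      rcases le_total a m with ha | ha <;> rcases le_total b m with hb | hb <;>
        simp [ha, hb, le_add_left, le_add_right]
    rw [size_sup hxy, min_add, hx.min_size, hy.min_size, ← min_add]

theorem exists_le_or_eq_top (m : ℕ) (x : A) :
    ∃ r : ℕ∞, IsCount m x r ∧ (r = ⊤ ∨ ∃ i : ℕ, i ≤ m ∧ r = i) := by
  by_cases hx : IsFin x
  · obtain ⟨i, hi⟩ := ENat.ne_top_iff_exists.1
      ((min_le_right (size x) m).trans_lt (ENat.natCast_lt_top m)).ne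
    have him : (i : ℕ∞) ≤ m := hi ▸ min_le_right _ _
    refine ⟨i, ⟨iff_of_true hx (ENat.natCast_ne_top i), ?_⟩, .inr ⟨i, Nat.cast_le.1 him, rfl⟩⟩
    rw [min_eq_left him, hi]
  · exact ⟨⊤, top_of_not_isFin hx, .inl rfl⟩

theorem exists_mem_splits (h : IsCount (2 * m) x r) (y : A) :
    ∃ s ∈ splits m r, IsCount m (x ⊓ y) s.1 ∧ IsCount m (x ⊓ yᶜ) s.2 := by
  by_cases hx : IsFin x
  · lift r to ℕ using h.isFin_iff.1 hx
    obtain ⟨hy, hyc⟩ := (isFin_inf_and_isFin_inf_compl x y).2 hx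
    obtain ⟨p, q, hpq, -, hp, hq⟩ :=
      exists_add_eq_of_min_eq (size_inf_add_size_inf_compl x y ▸ h.min_size)
    obtain ⟨hp', hq'⟩ := ne_top_of_add_eq_natCast hpq
    exact ⟨(p, q), mem_splits_natCast.2 hpq, ⟨iff_of_true hy hp', hp.symm⟩,
      ⟨iff_of_true hyc hq', hq.symm⟩⟩
  · obtain rfl : r = ⊤ := not_not.1 (h.isFin_iff.not.1 hx)
    obtain ⟨p, hp, hpm⟩ := exists_le_or_eq_top m (x ⊓ y)
    obtain ⟨q, hq, hqm⟩ := exists_le_or_eq_top m (x ⊓ yᶜ)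
    refine ⟨(p, q), mem_splits_top.2 ?_, hp, hq⟩
    have hne : ¬ (p ≠ ⊤ ∧ q ≠ ⊤) := by
      rwa [← hp.isFin_iff, ← hq.isFin_iff, isFin_inf_and_isFin_inf_compl]
    rcases hpm with rfl | ⟨i, hi, rfl⟩ <;> rcases hqm with rfl | ⟨j, hj, rfl⟩
    · exact .inl rfl
    · exact .inr ⟨j, hj, .inr rfl⟩
    · exact .inr ⟨i, hi, .inl rfl⟩
    · exact absurd ⟨ENat.natCast_ne_top i, ENat.natCast_ne_top j⟩ hne

theorem exists_natCast_top (hx : ¬ IsFin x) (i : ℕ) :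
    ∃ y, IsCount m (x ⊓ y) i ∧ IsCount m (x ⊓ yᶜ) ⊤ := by
  obtain ⟨y, hy, -⟩ := exists_size_inf_eq (x := x) (p := i) (q := ⊤)
    (by rw [size_eq_top_of_not_isFin hx, add_top]) (.inl (ENat.natCast_ne_top i))
  have hi : IsCount m (x ⊓ y) i := of_size_eq hy
  refine ⟨y, hi, top_of_not_isFin fun hyc => hx ?_⟩
  exact (isFin_inf_and_isFin_inf_compl x y).1 ⟨hi.isFin_iff.2 (ENat.natCast_ne_top i), hyc⟩

theorem exists_of_mem_splits (h : IsCount (2 * m) x r) {s : ℕ∞ × ℕ∞} (hs : s ∈ splits m r) :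
    ∃ y, IsCount m (x ⊓ y) s.1 ∧ IsCount m (x ⊓ yᶜ) s.2 := by
  by_cases hx : IsFin x
  · lift r to ℕ using h.isFin_iff.1 hx
    have hs' := mem_splits_natCast.1 hs
    have hne := ne_top_of_add_eq_natCast hs'
    obtain ⟨p, q, hpq, hpq', hp, hq⟩ := exists_add_eq_of_min_eq (hs' ▸ h.min_size.symm)
    obtain ⟨y, rfl, rfl⟩ := exists_size_inf_eq hpq hpq'
    have hy := (isFin_inf_and_isFin_inf_compl x y).2 hx
    exact ⟨y, ⟨iff_of_true hy.1 hne.1, hp⟩, ⟨iff_of_true hy.2 hne.2, hq⟩⟩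
  · obtain rfl : r = ⊤ := not_not.1 (h.isFin_iff.not.1 hx)
    rcases mem_splits_top.1 hs with rfl | ⟨i, -, rfl | rfl⟩
    · obtain ⟨y, hyx, hy, hyc⟩ := FinAlgebra.exists_split x hx
      rw [← inf_eq_right.2 hyx] at hy
      exact ⟨y, top_of_not_isFin hy, top_of_not_isFin hyc⟩
    · exact exists_natCast_top hx i
    · obtain ⟨y, hy, hyc⟩ := exists_natCast_top hx i
      exact ⟨yᶜ, hyc, by rwa [compl_compl]⟩

end IsCount

/-! ### Partitions into cells -/

/-- Lists of values labelled by sign vectors. The `i`-th sign in the label of a cell of a partition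
records whether the cell lies below the `i`-th parameter or below its complement. -/
abbrev Labelled (β : Type*) := List (List Bool × β)

/-- Cuts every cell along `x` and appends the new sign to its label. -/
def subdivide {β : Type*} [Min β] [Compl β] (π : Labelled β) (x : β) : Labelled β :=
  π.flatMap fun c => [(c.1 ++ [true], c.2 ⊓ x), (c.1 ++ [false], c.2 ⊓ xᶜ)]

/-- The partition of `⊤` generated by a tuple. It makes sense for tuples of terms as well, where it
yields terms for the cells. -/
def cells {β : Type*} [Top β] [Min β] [Compl β] : {n : ℕ} → (Fin n → β) → Labelled β
  | 0, _ => [([], ⊤)]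
  | _ + 1, a => subdivide (cells (Fin.init a)) (a (Fin.last _))

theorem cells_comp {β γ : Type*} [Top β] [Min β] [Compl β] [Top γ] [Min γ] [Compl γ] {f : β → γ}
    (htop : f ⊤ = ⊤) (hinf : ∀ x y, f (x ⊓ y) = f x ⊓ f y) (hcompl : ∀ x, f xᶜ = (f x)ᶜ) {n : ℕ}
    (a : Fin n → β) : cells (f ∘ a) = (cells a).map (Prod.map id f) := by
  induction n with
  | zero => simp [cells, htop]
  | succ n ih =>
    have hinit : Fin.init (f ∘ a) = f ∘ Fin.init a := rfl
    simp [cells, subdivide, hinit, ih, List.flatMap_map, List.map_flatMap, hinf, hcompl]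

theorem cells_snoc {β : Type*} [Top β] [Min β] [Compl β] {n : ℕ} (a : Fin n → β) (x : β) :
    cells (Fin.snoc a x : Fin (n + 1) → β) = subdivide (cells a) x := by
  rw [cells, Fin.init_snoc, Fin.snoc_last]

section BooleanAlgebra

variable {A : Type*} [BooleanAlgebra A]

/-- The cell `c` decides `x`: it lies below `x` or below `xᶜ`, according to the truth value. -/
def Decides (c x : A) (b : Bool) : Prop := c ≤ bif b then x else xᶜ

namespace Decides

variable {c x y : A} {b b' : Bool}

theorem mono {d : A} (h : Decides c x b) (hd : d ≤ c) : Decides d x b := hd.trans h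

theorem bot : Decides c ⊥ false := le_top.trans_eq compl_bot.symm

theorem top : Decides c ⊤ true := le_top

theorem compl (h : Decides c x b) : Decides c xᶜ (!b) := by
  cases b
  · exact h
  · exact h.trans_eq (compl_compl x).symm

theorem inf (hx : Decides c x b) (hy : Decides c y b') : Decides c (x ⊓ y) (b && b') := by
  cases b
  · exact le_trans hx (compl_le_compl inf_le_left)
  cases b'
  · exact le_trans hy (compl_le_compl inf_le_right)
  · exact le_inf hx hy

theorem sup (hx : Decides c x b) (hy : Decides c y b') : Decides c (x ⊔ y) (b || b') := by
  simpa only [compl_inf, compl_compl, Bool.not_and, Bool.not_not] using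
    (hx.compl.inf hy.compl).compl

theorem symmDiff (hx : Decides c x b) (hy : Decides c y b') :
    Decides c (symmDiff x y) (b ^^ b') := by
  rw [symmDiff_eq, show (b ^^ b') = (b && !b' || b' && !b) by cases b <;> cases b' <;> rfl]
  exact (hx.inf hy.compl).sup (hy.inf hx.compl)

theorem inf_eq (h : Decides c x b) : c ⊓ x = bif b then c else ⊥ := by
  cases b
  · exact (le_compl_iff_disjoint_right.1 h).eq_bot
  · exact inf_eq_left.2 h

end Decides

/-- The entries of the list are pairwise disjoint with supremum `x`. Empty cells are allowed. -/
inductive IsPartition : Labelled A → A → Prop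
  | nil : IsPartition [] ⊥
  | cons {c : List Bool × A} {π : Labelled A} {x : A} (hc : Disjoint c.2 x) (hπ : IsPartition π x) :
    IsPartition (c :: π) (c.2 ⊔ x)

theorem IsPartition.le {π : Labelled A} {x : A} (h : IsPartition π x) : ∀ c ∈ π, c.2 ≤ x := by
  induction h with
  | nil => exact fun c hc => absurd hc List.not_mem_nil
  | cons _ _ ih =>
    exact List.forall_mem_cons.2 ⟨le_sup_left, fun c hc => (ih c hc).trans le_sup_right⟩

theorem IsPartition.subdivide {π : Labelled A} {x : A} (h : IsPartition π x) (y : A) :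
    IsPartition (subdivide π y) x := by
  induction h with
  | nil => exact .nil
  | @cons c π x hc _ ih =>
    have hx : c.2 ⊔ x = c.2 ⊓ y ⊔ (c.2 ⊓ yᶜ ⊔ x) := by
      rw [← sup_assoc, ← inf_sup_left, sup_compl_eq_top, inf_top_eq]
    rw [hx]
    exact .cons (.sup_right (disjoint_compl_right.mono inf_le_right inf_le_right)
      (hc.mono_left inf_le_left)) (.cons (hc.mono_left inf_le_left) ih)

theorem isPartition_cells {n : ℕ} (a : Fin n → A) : IsPartition (cells a) ⊤ := by
  induction n with
  | zero => simpa [cells] using IsPartition.cons (c := ([], (⊤ : A))) disjoint_bot_right .nil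
  | succ n ih => exact (ih _).subdivide _

theorem decides_of_mem_cells {n : ℕ} {a : Fin n → A} {c : List Bool × A} (hc : c ∈ cells a) :
    c.1.length = n ∧ ∀ i : Fin n, Decides c.2 (a i) (c.1.getD i false) := by
  induction n generalizing c with
  | zero =>
    obtain rfl := List.mem_singleton.1 hc
    exact ⟨rfl, fun i => i.elim0⟩
  | succ n ih =>
    obtain ⟨d, hd, hc⟩ := List.mem_flatMap.1 hc
    obtain ⟨hlen, hdec⟩ := ih hd
    obtain ⟨b, hb, hdc, hlast⟩ :
        ∃ b, c.1 = d.1 ++ [b] ∧ c.2 ≤ d.2 ∧ Decides c.2 (a (Fin.last n)) b := by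
      rcases List.mem_pair.1 hc with rfl | rfl
      exacts [⟨true, rfl, inf_le_left, inf_le_right⟩, ⟨false, rfl, inf_le_left, inf_le_right⟩]
    rw [hb]
    refine ⟨by rw [List.length_append, hlen, List.length_singleton], Fin.lastCases ?_ fun i => ?_⟩
    · rwa [Fin.val_last, List.getD_append_right _ _ _ _ hlen.le, hlen, Nat.sub_self]
    · rw [List.getD_append _ _ _ _ (hlen ▸ i.isLt)]
      exact (hdec i).mono hdc

theorem inf_compl_congr {c x y : A} (h : c ⊓ x = c ⊓ y) : c ⊓ xᶜ = c ⊓ yᶜ := by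
  rw [← sdiff_eq, ← sdiff_inf_self_left, h, sdiff_inf_self_left, sdiff_eq]

theorem subdivide_congr {π : Labelled A} {x y : A} (h : ∀ c ∈ π, c.2 ⊓ x = c.2 ⊓ y) :
    subdivide π x = subdivide π y := by
  refine List.flatMap_congr fun c hc => ?_
  rw [h c hc, inf_compl_congr (h c hc)]

end BooleanAlgebra

/-- The total count of the cells whose labels satisfy `P`. -/
def mass (P : List Bool → Bool) (σ : Labelled ℕ∞) : ℕ∞ :=
  (σ.map fun c => bif P c.1 then c.2 else 0).sum

/-- The counts up to `m` that the cells of a partition can have after subdivision, when their counts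
up to `2 * m` before the subdivision are given. -/
def refinements (m : ℕ) (σ : Labelled ℕ∞) : List (Labelled ℕ∞) :=
  σ.foldr (fun c τs => (splits m c.2).flatMap fun s =>
    τs.map fun τ => (c.1 ++ [true], s.1) :: (c.1 ++ [false], s.2) :: τ) [ [] ]

/-- `σ` lists the counts up to `m` of the cells in `π`. -/
def Counts {A : Type*} [BooleanAlgebra A] [lang.Structure A] (m : ℕ) (π : Labelled A)
    (σ : Labelled ℕ∞) : Prop :=
  List.Forall₂ (fun c d => c.1 = d.1 ∧ IsCount m c.2 d.2) π σ

theorem mem_refinements_cons {m : ℕ} {d : List Bool × ℕ∞} {σ τ : Labelled ℕ∞} :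
    τ ∈ refinements m (d :: σ) ↔ ∃ s ∈ splits m d.2, ∃ τ' ∈ refinements m σ,
      (d.1 ++ [true], s.1) :: (d.1 ++ [false], s.2) :: τ' = τ := by
  simp only [refinements, List.foldr_cons, List.mem_flatMap, List.mem_map]

namespace Counts

variable {A : Type*} [BooleanAlgebra A] [lang.Structure A] {m : ℕ} {π : Labelled A}
  {σ τ : Labelled ℕ∞} {x : A}

theorem mono {m' : ℕ} (h : Counts m π σ) (hm : m' ≤ m) : Counts m' π σ :=
  List.Forall₂.imp (fun _ _ hcd => ⟨hcd.1, hcd.2.mono hm⟩) h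

variable [FinAlgebra A]

theorem isCount_mass (hπ : IsPartition π x) (h : Counts m π σ) {z : A} {P : List Bool → Bool}
    (hP : ∀ c ∈ π, Decides c.2 z (P c.1)) : IsCount m (x ⊓ z) (mass P σ) := by
  induction hπ generalizing σ with
  | nil =>
    cases h
    rw [bot_inf_eq]
    exact .bot m
  | @cons c π x hc _ ih =>
    obtain _ | @⟨_, d, _, σ, ⟨hlabel, hcount⟩, hσ⟩ := h
    obtain ⟨hcP, hP⟩ := List.forall_mem_cons.1 hP
    rw [inf_sup_right, mass, List.map_cons, List.sum_cons]
    refine .sup (hc.mono inf_le_left inf_le_left) ?_ (ih hσ hP)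
    rw [hcP.inf_eq, ← hlabel]
    cases P c.1
    exacts [.bot m, hcount]

theorem exists_mem_refinements (h : Counts (2 * m) π σ) (y : A) :
    ∃ τ ∈ refinements m σ, Counts m (subdivide π y) τ := by
  induction h with
  | nil => exact ⟨[], List.mem_singleton_self [], .nil⟩
  | @cons c d π σ hcd _ ih =>
    obtain ⟨τ, hτ, hcounts⟩ := ih
    obtain ⟨s, hs, hs₁, hs₂⟩ := hcd.2.exists_mem_splits y
    refine ⟨_, mem_refinements_cons.2 ⟨s, hs, τ, hτ, rfl⟩, ?_⟩
    rw [← hcd.1]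
    exact .cons ⟨rfl, hs₁⟩ (.cons ⟨rfl, hs₂⟩ hcounts)

theorem exists_of_mem_refinements (hπ : IsPartition π x) (h : Counts (2 * m) π σ)
    (hτ : τ ∈ refinements m σ) : ∃ y ≤ x, Counts m (subdivide π y) τ := by
  induction hπ generalizing σ τ with
  | nil =>
    cases h
    obtain rfl := List.mem_singleton.1 hτ
    exact ⟨⊥, le_rfl, .nil⟩
  | @cons c π x hc hπ ih =>
    obtain _ | @⟨_, d, _, σ, ⟨hlabel, hcount⟩, hσ⟩ := h
    obtain ⟨s, hs, τ', hτ', rfl⟩ := mem_refinements_cons.1 hτ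
    obtain ⟨y, hyx, hy⟩ := ih hσ hτ'
    obtain ⟨z, hz₁, hz₂⟩ := hcount.exists_of_mem_splits hs
    have hcy : c.2 ⊓ (c.2 ⊓ z ⊔ y) = c.2 ⊓ z := by
      rw [inf_sup_left, ← inf_assoc, inf_idem, (hc.mono_right hyx).eq_bot, sup_bot_eq]
    have hπy : ∀ d ∈ π, d.2 ⊓ (c.2 ⊓ z ⊔ y) = d.2 ⊓ y := fun d hd => by
      rw [inf_sup_left, (hc.symm.mono (hπ.le d hd) inf_le_left).eq_bot, bot_sup_eq]
    refine ⟨c.2 ⊓ z ⊔ y, sup_le_sup inf_le_left hyx, .cons ⟨?_, ?_⟩ (.cons ⟨?_, ?_⟩ ?_)⟩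
    · rw [hlabel]
    · rwa [hcy]
    · rw [hlabel]
    · rwa [inf_compl_congr hcy]
    · rwa [← subdivide_congr hπy] at hy

end Counts

/-! ### Recursion on Gödel numbers -/

section Codes

/-- The first entry of a code, which determines the outermost symbol. -/
def tag (c : ℕ) : ℕ := c.unpair.1

/-- The part of a code following its tag; it codes the only argument of a unary symbol. -/
def body (c : ℕ) : ℕ := c.unpair.2

/-- The first component of the body of a code; it codes the first argument of a binary symbol. -/
def left (c : ℕ) : ℕ := (body c).unpair.1

/-- The second component of the body of a code; it codes the second argument of a binary symbol. -/
def right (c : ℕ) : ℕ := (body c).unpair.2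

@[simp] theorem tag_pair (t b : ℕ) : tag (Nat.pair t b) = t := by simp [tag]

@[simp] theorem body_pair (t b : ℕ) : body (Nat.pair t b) = b := by simp [body]

@[simp] theorem left_pair (t x y : ℕ) : left (Nat.pair t (Nat.pair x y)) = x := by simp [left]

@[simp] theorem right_pair (t x y : ℕ) : right (Nat.pair t (Nat.pair x y)) = y := by simp [right]

theorem pair_tag_body (c : ℕ) : Nat.pair (tag c) (body c) = c := Nat.pair_unpair c

theorem pair_left_right (c : ℕ) : Nat.pair (left c) (right c) = body c := Nat.pair_unpair _

theorem body_lt {c : ℕ} (h : tag c ≠ 0) : body c < c := by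
  have := Nat.add_le_pair (tag c) (body c)
  rw [pair_tag_body] at this
  omega

theorem left_lt {c : ℕ} (h : tag c ≠ 0) : left c < c := (Nat.unpair_left_le _).trans_lt (body_lt h)

theorem right_lt {c : ℕ} (h : tag c ≠ 0) : right c < c :=
  (Nat.unpair_right_le _).trans_lt (body_lt h)

open Primrec

theorem primrec_tag : Primrec tag := fst.comp unpair

theorem primrec_body : Primrec body := snd.comp unpair

theorem primrec_left : Primrec left := fst.comp (unpair.comp primrec_body)

theorem primrec_right : Primrec right := snd.comp (unpair.comp primrec_body)

end Codes

section Recursion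

variable {α β : Type*} [Inhabited β] {args : α → ℕ → List (α × ℕ)} {step : α → ℕ → List β → β}

/-- Recursion on codes with a parameter: the value at `c` is obtained by `step` from the values at
the pairs listed by `args`, whose codes are meant to be smaller than `c`. -/
def codeRec (args : α → ℕ → List (α × ℕ)) (step : α → ℕ → List β → β) (a : α) (c : ℕ) : β :=
  step a c ((args a c).map fun p => if _h : p.2 < c then codeRec args step p.1 p.2 else default)
termination_by c

theorem codeRec_eq (h : ∀ a c, ∀ p ∈ args a c, p.2 < c) (a : α) (c : ℕ) :
    codeRec args step a c = step a c ((args a c).map fun p => codeRec args step p.1 p.2) := by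
  rw [codeRec]
  congr 1
  exact List.map_congr_left fun p hp => dif_pos (h a c p hp)

theorem primrec_codeRec [Primcodable α] [Primcodable β] (h : ∀ a c, ∀ p ∈ args a c, p.2 < c)
    (hargs : Primrec₂ args)
    (hstep : Primrec₂ fun (p : α × ℕ) (rs : List β) => step p.1 p.2 rs) :
    Primrec₂ (codeRec args step) :=
  Primrec.nat_omega_rec' (fun p : α × ℕ => codeRec args step p.1 p.2) Primrec.snd hargs
    (Primrec.option_some.comp₂ hstep) (fun p => h p.1 p.2) fun p => by rw [codeRec_eq h]

/-- The immediate subterms of a coded term, with an unchanged parameter. -/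
def termArgs (a : α) (c : ℕ) : List (α × ℕ) :=
  [ [], [], [], [(a, body c)], [(a, left c), (a, right c)], [(a, left c), (a, right c)] ].getD
    (tag c) []

/-- The immediate subformulas of a coded formula. The parameters for the subformula of a universal
formula are listed by `ext`. -/
def formulaArgs (ext : α → ℕ → List α) (a : α) (c : ℕ) : List (α × ℕ) :=
  [ [], [], [], [], [(a, left c), (a, right c)], (ext a (body c)).map (·, body c) ].getD (tag c) []

theorem lt_of_mem_termArgs (a : α) (c : ℕ) : ∀ p ∈ termArgs a c, p.2 < c := by
  rw [termArgs]
  rcases h : tag c with _ | _ | _ | _ | _ | _ | t <;> simp [body_lt, left_lt, right_lt, h]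

theorem lt_of_mem_formulaArgs (ext : α → ℕ → List α) (a : α) (c : ℕ) :
    ∀ p ∈ formulaArgs ext a c, p.2 < c := by
  rw [formulaArgs]
  rcases h : tag c with _ | _ | _ | _ | _ | _ | t <;> simp [body_lt, left_lt, right_lt, h]

open Primrec

variable [Primcodable α]

theorem primrec_termArgs : Primrec₂ (termArgs (α := α)) := by
  have hu : Primrec fun p : α × ℕ => [(p.1, body p.2)] :=
    list_cons.comp (fst.pair (primrec_body.comp snd)) (const [])
  have hb : Primrec fun p : α × ℕ => [(p.1, left p.2), (p.1, right p.2)] :=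
    list_cons.comp (fst.pair (primrec_left.comp snd))
      (list_cons.comp (fst.pair (primrec_right.comp snd)) (const []))
  exact (list_getD []).comp
    (list_cons.comp (const []) <| list_cons.comp (const []) <| list_cons.comp (const []) <|
      list_cons.comp hu <| list_cons.comp hb <| list_cons.comp hb <| const [])
    (primrec_tag.comp snd)

theorem primrec_formulaArgs {ext : α → ℕ → List α} (hext : Primrec₂ ext) :
    Primrec₂ (formulaArgs ext) := by
  have hb : Primrec fun p : α × ℕ => [(p.1, left p.2), (p.1, right p.2)] :=
    list_cons.comp (fst.pair (primrec_left.comp snd))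
      (list_cons.comp (fst.pair (primrec_right.comp snd)) (const []))
  have ha : Primrec fun p : α × ℕ => (ext p.1 (body p.2)).map (·, body p.2) :=
    list_map (hext.comp fst (primrec_body.comp snd))
      (snd.pair (primrec_body.comp (snd.comp fst))).to₂
  exact (list_getD []).comp
    (list_cons.comp (const []) <| list_cons.comp (const []) <| list_cons.comp (const []) <|
      list_cons.comp (const []) <| list_cons.comp hb <| list_cons.comp ha <| const [])
    (primrec_tag.comp snd)

end Recursion

section Induction

variable {n : ℕ} (s t : lang.Term (Empty ⊕ Fin n))

@[simp] theorem termCode_var (i : Fin n) :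
    termCode (.var (.inr i) : lang.Term (Empty ⊕ Fin n)) = Nat.pair 0 i := rfl

@[simp] theorem termCode_bot : termCode (⊥ : lang.Term (Empty ⊕ Fin n)) = Nat.pair 1 0 := rfl

@[simp] theorem termCode_top : termCode (⊤ : lang.Term (Empty ⊕ Fin n)) = Nat.pair 2 0 := rfl

@[simp] theorem termCode_compl : termCode tᶜ = Nat.pair 3 (termCode t) := rfl

@[simp] theorem termCode_inf :
    termCode (s ⊓ t) = Nat.pair 4 (Nat.pair (termCode s) (termCode t)) := rfl

@[simp] theorem termCode_sup :
    termCode (s ⊔ t) = Nat.pair 5 (Nat.pair (termCode s) (termCode t)) := rfl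

@[simp] theorem code_falsum :
    code (BoundedFormula.falsum : lang.BoundedFormula Empty n) = Nat.pair 0 0 := rfl

@[simp] theorem code_equal :
    code (BoundedFormula.equal s t) = Nat.pair 1 (Nat.pair (termCode s) (termCode t)) := rfl

@[simp] theorem code_cF (k : ℕ+) : code (cF k t) = Nat.pair 2 (Nat.pair k (termCode t)) := rfl

@[simp] theorem code_finF : code (finF t) = Nat.pair 3 (termCode t) := rfl

@[simp] theorem code_imp (φ ψ : lang.BoundedFormula Empty n) :
    code (φ.imp ψ) = Nat.pair 4 (Nat.pair (code φ) (code ψ)) := rfl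

@[simp] theorem code_all (φ : lang.BoundedFormula Empty (n + 1)) :
    code φ.all = Nat.pair 5 (code φ) := rfl

variable {s t}

@[elab_as_elim]
theorem term_induction {motive : lang.Term (Empty ⊕ Fin n) → Prop}
    (var : ∀ i : Fin n, motive (.var (.inr i)))
    (bot : motive ⊥) (top : motive ⊤) (compl : ∀ t, motive t → motive tᶜ)
    (inf : ∀ s t, motive s → motive t → motive (s ⊓ t))
    (sup : ∀ s t, motive s → motive t → motive (s ⊔ t)) (t : lang.Term (Empty ⊕ Fin n)) :
    motive t := by
  induction t with
  | var i =>
    rcases i with e | i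
    exacts [e.elim, var i]
  | func f ts ih =>
    cases f with
    | bot => exact (List.ofFn_injective rfl : ![] = ts) ▸ bot
    | top => exact (List.ofFn_injective rfl : ![] = ts) ▸ top
    | compl => exact (List.ofFn_injective rfl : ![ts 0] = ts) ▸ compl _ (ih 0)
    | inf => exact (List.ofFn_injective rfl : ![ts 0, ts 1] = ts) ▸ inf _ _ (ih 0) (ih 1)
    | sup => exact (List.ofFn_injective rfl : ![ts 0, ts 1] = ts) ▸ sup _ _ (ih 0) (ih 1)

@[elab_as_elim]
theorem formula_induction {motive : ∀ n, lang.BoundedFormula Empty n → Prop}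
    (falsum : ∀ n, motive n .falsum) (equal : ∀ n s t, motive n (.equal s t))
    (cF : ∀ n k t, motive n (cF k t)) (finF : ∀ n t, motive n (finF t))
    (imp : ∀ n φ ψ, motive n φ → motive n ψ → motive n (.imp φ ψ))
    (all : ∀ n φ, motive (n + 1) φ → motive n (.all φ)) {n : ℕ} (φ : lang.BoundedFormula Empty n) :
    motive n φ := by
  induction φ with
  | falsum => exact falsum _
  | equal s t => exact equal _ s t
  | rel r ts =>
    cases r with
    | C k => exact (List.ofFn_injective rfl : ![ts 0] = ts) ▸ cF _ k (ts 0)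
    | fin => exact (List.ofFn_injective rfl : ![ts 0] = ts) ▸ finF _ (ts 0)
  | imp φ ψ ihφ ihψ => exact imp _ φ ψ ihφ ihψ
  | all φ ih => exact all _ φ ih

end Induction

/-! ### Evaluation of coded formulas -/

section Validity

/-- Whether a number is the code of a term with `n` variables in scope. -/
def termValid : ℕ → ℕ → Bool :=
  codeRec termArgs fun n c rs =>
    [decide (body c < n), decide (body c = 0), decide (body c = 0), rs.getD 0 false,
      rs.getD 0 false && rs.getD 1 false, rs.getD 0 false && rs.getD 1 false].getD (tag c) false

/-- Whether a number is the code of a formula with `n` variables in scope. -/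
def formulaValid : ℕ → ℕ → Bool :=
  codeRec (formulaArgs fun n _ => [n + 1]) fun n c rs =>
    [decide (body c = 0), termValid n (left c) && termValid n (right c),
      decide (0 < left c) && termValid n (right c), termValid n (body c),
      rs.getD 0 false && rs.getD 1 false, rs.getD 0 false].getD (tag c) false

theorem termValid_eq (n c : ℕ) : termValid n c =
    [decide (body c < n), decide (body c = 0), decide (body c = 0), termValid n (body c),
      termValid n (left c) && termValid n (right c),
      termValid n (left c) && termValid n (right c)].getD (tag c) false := by
  rw [termValid, codeRec_eq lt_of_mem_termArgs, termArgs]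
  rcases tag c with _ | _ | _ | _ | _ | _ | t <;> rfl

theorem formulaValid_eq (n c : ℕ) : formulaValid n c =
    [decide (body c = 0), termValid n (left c) && termValid n (right c),
      decide (0 < left c) && termValid n (right c), termValid n (body c),
      formulaValid n (left c) && formulaValid n (right c),
      formulaValid (n + 1) (body c)].getD (tag c) false := by
  rw [formulaValid, codeRec_eq (lt_of_mem_formulaArgs _), formulaArgs]
  rcases tag c with _ | _ | _ | _ | _ | _ | t <;> rfl

theorem termValid_termCode {n : ℕ} (t : lang.Term (Empty ⊕ Fin n)) :
    termValid n (termCode t) = true := by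
  induction t using term_induction <;> rw [termValid_eq] <;> simp [*]

theorem exists_termCode_eq {n c : ℕ} (h : termValid n c = true) :
    ∃ t : lang.Term (Empty ⊕ Fin n), termCode t = c := by
  induction c using Nat.strong_induction_on with
  | _ c ih =>
    rw [termValid_eq] at h
    rw [← pair_tag_body c]
    rcases htag : tag c with _ | _ | _ | _ | _ | _ | t <;> rw [htag] at h <;>
      simp only [List.getD_cons_zero, List.getD_cons_succ, List.getD_nil, decide_eq_true_eq,
        Bool.and_eq_true, Bool.false_eq_true] at h
    · exact ⟨.var (.inr ⟨body c, h⟩), rfl⟩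
    · exact ⟨⊥, by rw [h, termCode_bot]⟩
    · exact ⟨⊤, by rw [h, termCode_top]⟩
    · obtain ⟨t, ht⟩ := ih _ (body_lt (by lia)) h
      exact ⟨tᶜ, by rw [termCode_compl, ht]⟩
    · obtain ⟨s, hs⟩ := ih _ (left_lt (by lia)) h.1
      obtain ⟨t, ht⟩ := ih _ (right_lt (by lia)) h.2
      exact ⟨s ⊓ t, by rw [termCode_inf, hs, ht, pair_left_right]⟩
    · obtain ⟨s, hs⟩ := ih _ (left_lt (by lia)) h.1
      obtain ⟨t, ht⟩ := ih _ (right_lt (by lia)) h.2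
      exact ⟨s ⊔ t, by rw [termCode_sup, hs, ht, pair_left_right]⟩

theorem formulaValid_code {n : ℕ} (φ : lang.BoundedFormula Empty n) :
    formulaValid n (code φ) = true := by
  induction φ using formula_induction <;> rw [formulaValid_eq] <;> simp [termValid_termCode, *]

theorem exists_code_eq {n c : ℕ} (h : formulaValid n c = true) :
    ∃ φ : lang.BoundedFormula Empty n, code φ = c := by
  induction c using Nat.strong_induction_on generalizing n with
  | _ c ih =>
    rw [formulaValid_eq] at h
    rw [← pair_tag_body c]
    rcases htag : tag c with _ | _ | _ | _ | _ | _ | t <;> rw [htag] at h <;>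
      simp only [List.getD_cons_zero, List.getD_cons_succ, List.getD_nil, decide_eq_true_eq,
        Bool.and_eq_true, Bool.false_eq_true] at h
    · exact ⟨.falsum, by rw [h, code_falsum]⟩
    · obtain ⟨s, hs⟩ := exists_termCode_eq h.1
      obtain ⟨t, ht⟩ := exists_termCode_eq h.2
      exact ⟨.equal s t, by rw [code_equal, hs, ht, pair_left_right]⟩
    · obtain ⟨t, ht⟩ := exists_termCode_eq h.2
      obtain ⟨k, hk⟩ : ∃ k : ℕ+, (k : ℕ) = left c := ⟨⟨left c, h.1⟩, rfl⟩
      exact ⟨cF k t, by rw [code_cF, hk, ht, pair_left_right]⟩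
    · obtain ⟨t, ht⟩ := exists_termCode_eq h
      exact ⟨finF t, by rw [code_finF, ht]⟩
    · obtain ⟨φ, hφ⟩ := ih _ (left_lt (by lia)) h.1
      obtain ⟨ψ, hψ⟩ := ih _ (right_lt (by lia)) h.2
      exact ⟨.imp φ ψ, by rw [code_imp, hφ, hψ, pair_left_right]⟩
    · obtain ⟨φ, hφ⟩ := ih _ (body_lt (by lia)) h
      exact ⟨.all φ, by rw [code_all, hφ]⟩

theorem formulaValid_iff {n c : ℕ} :
    formulaValid n c = true ↔ ∃ φ : lang.BoundedFormula Empty n, code φ = c :=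
  ⟨exists_code_eq, fun ⟨φ, h⟩ => h ▸ formulaValid_code φ⟩

end Validity

section Truth

/-- The truth value of the coded term on a cell with the label `v`. -/
def termValue : List Bool → ℕ → Bool :=
  codeRec termArgs fun v c rs =>
    [v.getD (body c) false, false, true, !rs.getD 0 false, rs.getD 0 false && rs.getD 1 false,
      rs.getD 0 false || rs.getD 1 false].getD (tag c) false

/-- The truth value of the coded formula at a tuple, computed from the counts of the cells of the
partition generated by the tuple. At the code `c` counts up to `2 ^ c` suffice: a quantifier halves
the bound, and the code of a formula exceeds the indices of the predicates `C_n` in it. -/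
def truth : Labelled ℕ∞ → ℕ → Bool :=
  codeRec (formulaArgs fun σ c => refinements (2 ^ c) σ) fun σ c rs =>
    [false, decide (mass (fun v => termValue v (left c) ^^ termValue v (right c)) σ = 0),
      decide (left c ≤ mass (termValue · (right c)) σ),
      decide (mass (termValue · (body c)) σ ≠ ⊤),
      !rs.getD 0 false || rs.getD 1 false, rs.all id].getD (tag c) false

theorem termValue_eq (v : List Bool) (c : ℕ) : termValue v c =
    [v.getD (body c) false, false, true, !termValue v (body c),
      termValue v (left c) && termValue v (right c),
      termValue v (left c) || termValue v (right c)].getD (tag c) false := by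
  rw [termValue, codeRec_eq lt_of_mem_termArgs, termArgs]
  rcases tag c with _ | _ | _ | _ | _ | _ | t <;> rfl

theorem truth_eq (σ : Labelled ℕ∞) (c : ℕ) : truth σ c =
    [false, decide (mass (fun v => termValue v (left c) ^^ termValue v (right c)) σ = 0),
      decide (left c ≤ mass (termValue · (right c)) σ),
      decide (mass (termValue · (body c)) σ ≠ ⊤),
      !truth σ (left c) || truth σ (right c),
      (refinements (2 ^ body c) σ).all (truth · (body c))].getD (tag c) false := by
  rw [truth, codeRec_eq (lt_of_mem_formulaArgs _), formulaArgs]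
  rcases tag c with _ | _ | _ | _ | _ | _ | t
  case succ.succ.succ.succ.succ.zero =>
    simp [List.all_map, Function.comp_def]
  all_goals rfl

end Truth

/-! ### Primitive recursiveness -/

section Primrec

open Primrec

/-- Extended natural numbers are coded as elements of `Option ℕ`, which they are by definition. -/
instance primcodableENat : Primcodable ℕ∞ := .ofEquiv (Option ℕ) (.refl _)

variable {α β : Type*} [Primcodable α] [Primcodable β]

theorem primrec_natCast_enat : Primrec ((↑) : ℕ → ℕ∞) :=
  (of_equiv_iff (.refl (Option ℕ))).1 option_some

theorem primrec_recTopCoe {f : α → ℕ∞} {g : α → β} {h : α → ℕ → β} (hf : Primrec f)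
    (hg : Primrec g) (hh : Primrec₂ h) :
    Primrec fun a => WithTop.recTopCoe (C := fun _ => β) (g a) (h a) (f a) :=
  (option_casesOn (of_equiv.comp hf) hg hh).of_eq fun a => by cases f a <;> rfl

theorem primrec_enat_toNat : Primrec ENat.toNat :=
  (primrec_recTopCoe .id (const 0) Primrec₂.right).of_eq fun r => by cases r <;> rfl

theorem primrec_enat_add : Primrec₂ ((· + ·) : ℕ∞ → ℕ∞ → ℕ∞) :=
  (primrec_recTopCoe snd (const ⊤) (primrec_recTopCoe (fst.comp fst) (const ⊤)
    (primrec_natCast_enat.comp (nat_add.comp snd (snd.comp fst))).to₂).to₂).of_eq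
    fun ⟨p, q⟩ => by cases p <;> cases q <;> rfl

theorem primrecRel_natCast_le : PrimrecRel fun (k : ℕ) (r : ℕ∞) => k ≤ r := by
  refine (primrec_recTopCoe snd (const true) (nat_le.decide.comp (fst.comp fst) snd).to₂).of_eq
    (g := fun p : ℕ × ℕ∞ => decide ((p.1 : ℕ∞) ≤ p.2)) (fun ⟨k, r⟩ => ?_) |>.primrecPred
  cases r with
  | top => exact (decide_eq_true le_top).symm
  | coe n => exact decide_eq_decide.2 Nat.cast_le.symm

theorem primrec_two_pow : Primrec fun n : ℕ => 2 ^ n :=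
  (Primrec₂.unpaired'.1 Nat.Primrec.pow).comp (const 2) .id

theorem primrec_list_all : Primrec fun l : List Bool => l.all id :=
  (list_foldr .id (const true) (Primrec.and.comp (fst.comp snd) (snd.comp snd)).to₂).of_eq
    fun l => by induction l with
      | nil => rfl
      | cons b l ih => exact congrArg (b && ·) ih

theorem primrec_mass {P : α → List Bool → Bool} {σ : α → Labelled ℕ∞} (hP : Primrec₂ P)
    (hσ : Primrec σ) : Primrec fun a => mass (P a) (σ a) := by
  have hval : Primrec₂ fun (a : α) (c : List Bool × ℕ∞) => bif P a c.1 then c.2 else 0 :=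
    Primrec.cond (hP.comp fst (fst.comp snd)) (snd.comp snd) (const 0)
  exact list_foldr (list_map hσ hval) (const 0)
    (primrec_enat_add.comp (fst.comp snd) (snd.comp snd)).to₂

theorem primrec_splits : Primrec₂ splits := by
  have hr : Primrec fun p : ℕ × ℕ∞ => p.2.toNat := primrec_enat_toNat.comp snd
  have hcast : Primrec fun q : (ℕ × ℕ∞) × ℕ => (q.2 : ℕ∞) := primrec_natCast_enat.comp snd
  refine ite (Primrec.eq.comp snd (const ⊤)) (list_cons.comp (const _) ?_) ?_
  · refine list_flatMap (list_range.comp (succ.comp fst)) ?_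
    exact list_cons.comp (hcast.pair (const ⊤)) (list_cons.comp ((const ⊤).pair hcast) (const []))
  · refine list_map (list_map (list_range.comp (succ.comp hr))
      (snd.pair (nat_sub.comp (hr.comp fst) snd)).to₂) ?_
    exact (primrec_natCast_enat.comp (fst.comp snd)).pair (primrec_natCast_enat.comp (snd.comp snd))

theorem primrec_refinements : Primrec₂ refinements := by
  refine list_foldr snd (const [ [] ])
    (h := fun (p : ℕ × Labelled ℕ∞) (q : (List Bool × ℕ∞) × List (Labelled ℕ∞)) =>
      (splits p.1 q.1.2).flatMap fun s =>
        q.2.map fun τ => (q.1.1 ++ [true], s.1) :: (q.1.1 ++ [false], s.2) :: τ) ?_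
  refine list_flatMap (primrec_splits.comp (fst.comp fst) (snd.comp (fst.comp snd))) ?_
  refine list_map (snd.comp (snd.comp fst)) ?_
  have hlabel : Primrec fun q : (((ℕ × Labelled ℕ∞) × (List Bool × ℕ∞) × List (Labelled ℕ∞)) ×
      ℕ∞ × ℕ∞) × Labelled ℕ∞ => q.1.1.2.1.1 :=
    fst.comp (fst.comp (snd.comp (fst.comp fst)))
  exact list_cons.comp ((list_concat.comp hlabel (const true)).pair (fst.comp (snd.comp fst)))
    (list_cons.comp ((list_concat.comp hlabel (const false)).pair (snd.comp (snd.comp fst))) snd)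

theorem primrec_nth_bool {f : α → List Bool} (hf : Primrec f) (i : ℕ) :
    Primrec fun a => (f a).getD i false :=
  (list_getD false).comp hf (const i)

theorem primrec_termValid : Primrec₂ termValid := by
  refine primrec_codeRec lt_of_mem_termArgs primrec_termArgs ?_
  have hc : Primrec fun p : (ℕ × ℕ) × List Bool => p.1.2 := snd.comp fst
  have hzero := (Primrec.eq.comp (primrec_body.comp hc) (const 0)).decide
  have hx := primrec_nth_bool (α := (ℕ × ℕ) × List Bool) snd 0
  have hand := Primrec.and.comp hx (primrec_nth_bool snd 1)
  exact (list_getD false).comp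
    (list_cons.comp (nat_lt.comp (primrec_body.comp hc) (fst.comp fst)).decide <|
      list_cons.comp hzero <| list_cons.comp hzero <| list_cons.comp hx <|
      list_cons.comp hand <| list_cons.comp hand <| const [])
    (primrec_tag.comp hc)

theorem primrec_formulaValid : Primrec₂ formulaValid := by
  refine primrec_codeRec (lt_of_mem_formulaArgs _)
    (primrec_formulaArgs (list_cons.comp (succ.comp fst) (const []))) ?_
  have hc : Primrec fun p : (ℕ × ℕ) × List Bool => p.1.2 := snd.comp fst
  have hterm {f : ℕ → ℕ} (hf : Primrec f) :
      Primrec fun p : (ℕ × ℕ) × List Bool => termValid p.1.1 (f p.1.2) :=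
    primrec_termValid.comp (fst.comp fst) (hf.comp hc)
  have hx := primrec_nth_bool (α := (ℕ × ℕ) × List Bool) snd 0
  exact (list_getD false).comp
    (list_cons.comp (Primrec.eq.comp (primrec_body.comp hc) (const 0)).decide <|
      list_cons.comp (Primrec.and.comp (hterm primrec_left) (hterm primrec_right)) <|
      list_cons.comp (Primrec.and.comp (nat_lt.comp (const 0) (primrec_left.comp hc)).decide
        (hterm primrec_right)) <|
      list_cons.comp (hterm primrec_body) <|
      list_cons.comp (Primrec.and.comp hx (primrec_nth_bool snd 1)) <|
      list_cons.comp hx <| const [])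
    (primrec_tag.comp hc)

theorem primrec_termValue : Primrec₂ termValue := by
  refine primrec_codeRec lt_of_mem_termArgs primrec_termArgs ?_
  have hc : Primrec fun p : (List Bool × ℕ) × List Bool => p.1.2 := snd.comp fst
  have hx := primrec_nth_bool (α := (List Bool × ℕ) × List Bool) snd 0
  have hy := primrec_nth_bool (α := (List Bool × ℕ) × List Bool) snd 1
  exact (list_getD false).comp
    (list_cons.comp ((list_getD false).comp (fst.comp fst) (primrec_body.comp hc)) <|
      list_cons.comp (const false) <| list_cons.comp (const true) <|
      list_cons.comp (Primrec.not.comp hx) <| list_cons.comp (Primrec.and.comp hx hy) <|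
      list_cons.comp (Primrec.or.comp hx hy) <| const [])
    (primrec_tag.comp hc)

theorem primrec_truth : Primrec₂ truth := by
  refine primrec_codeRec (lt_of_mem_formulaArgs _)
    (primrec_formulaArgs (primrec_refinements.comp (primrec_two_pow.comp snd) fst)) ?_
  have hc : Primrec fun p : (Labelled ℕ∞ × ℕ) × List Bool => p.1.2 := snd.comp fst
  have hval {f : ℕ → ℕ} (hf : Primrec f) :
      Primrec₂ fun (p : (Labelled ℕ∞ × ℕ) × List Bool) v => termValue v (f p.1.2) :=
    primrec_termValue.comp snd ((hf.comp hc).comp fst)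
  have hmass {P : (Labelled ℕ∞ × ℕ) × List Bool → List Bool → Bool} (hP : Primrec₂ P) :
      Primrec fun p => mass (P p) p.1.1 :=
    primrec_mass hP (fst.comp fst)
  exact (list_getD false).comp
    (list_cons.comp (const false) <|
      list_cons.comp (Primrec.eq.comp (hmass <|
        (dom_bool₂ xor).comp₂ (hval primrec_left) (hval primrec_right)) (const 0)).decide <|
      list_cons.comp (primrecRel_natCast_le.comp (primrec_left.comp hc)
        (hmass (hval primrec_right))).decide <|
      list_cons.comp (Primrec.eq.comp (hmass (hval primrec_body)) (const ⊤)).not.decide <|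
      list_cons.comp (Primrec.or.comp (Primrec.not.comp (primrec_nth_bool snd 0))
        (primrec_nth_bool snd 1)) <|
      list_cons.comp (primrec_list_all.comp snd) <| const [])
    (primrec_tag.comp hc)

end Primrec

/-! ### Correctness of the evaluation -/

section Correctness

variable {A : Type*} [BooleanAlgebra A] [lang.Structure A] {n : ℕ} {a : Fin n → A}

theorem decides_termValue [IsBooleanStructure A] (t : lang.Term (Empty ⊕ Fin n))
    {c : List Bool × A} (hc : c ∈ cells a) :
    Decides c.2 (t.realize (Sum.elim default a)) (termValue c.1 (termCode t)) := by
  induction t using term_induction with rw [termValue_eq]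
  | var i => simpa using (decides_of_mem_cells hc).2 i
  | bot => simpa using Decides.bot
  | top => simpa using Decides.top
  | compl t ht => simpa using ht.compl
  | inf s t hs ht => simpa using hs.inf ht
  | sup s t hs ht => simpa using hs.sup ht

variable [FinAlgebra A] {σ : Labelled ℕ∞}

theorem Counts.isCount_realize {m : ℕ} (h : Counts m (cells a) σ)
    (t : lang.Term (Empty ⊕ Fin n)) :
    IsCount m (t.realize (Sum.elim default a)) (mass (termValue · (termCode t)) σ) := by
  simpa only [top_inf_eq] using
    h.isCount_mass (isPartition_cells a) fun c hc => decides_termValue t hc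

theorem Counts.realize_eq_iff {m : ℕ} (h : Counts m (cells a) σ) (hm : 1 ≤ m)
    (s t : lang.Term (Empty ⊕ Fin n)) :
    s.realize (Sum.elim default a) = t.realize (Sum.elim default a) ↔
      mass (fun v => termValue v (termCode s) ^^ termValue v (termCode t)) σ = 0 := by
  have hcount := h.isCount_mass (isPartition_cells a)
    (P := fun v => termValue v (termCode s) ^^ termValue v (termCode t)) fun c hc =>
      (decides_termValue s hc).symmDiff (decides_termValue t hc)
  rw [← hcount.eq_bot_iff hm, top_inf_eq, symmDiff_eq_bot]

theorem truth_code_iff (φ : lang.BoundedFormula Empty n) (h : Counts (2 ^ code φ) (cells a) σ) :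
    truth σ (code φ) = true ↔ φ.Realize default a := by
  induction φ using formula_induction generalizing σ with rw [truth_eq]
  | falsum n => simp [BoundedFormula.Realize]
  | equal n s t =>
    simpa [BoundedFormula.Realize] using (h.realize_eq_iff Nat.one_le_two_pow s t).symm
  | cF n k t =>
    have hk : (k : ℕ) ≤ 2 ^ code (cF k t) :=
      ((Nat.left_le_pair _ _).trans (Nat.right_le_pair _ _)).trans Nat.lt_two_pow_self.le
    simpa [FinAlgebra.relMap_C] using ((h.isCount_realize t).natCast_le_size_iff hk).symm
  | finF n t => simpa using (h.isCount_realize t).isFin_iff.symm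
  | imp n φ ψ ihφ ihψ =>
    have hφ : 2 ^ code φ ≤ 2 ^ code (φ.imp ψ) :=
      Nat.pow_le_pow_right two_pos ((Nat.left_le_pair _ _).trans (Nat.right_le_pair _ _))
    have hψ : 2 ^ code ψ ≤ 2 ^ code (φ.imp ψ) :=
      Nat.pow_le_pow_right two_pos ((Nat.right_le_pair _ _).trans (Nat.right_le_pair _ _))
    simp [← ihφ (h.mono hφ), ← ihψ (h.mono hψ), imp_iff_not_or]
  | all n φ ih =>
    have hφ : 2 * 2 ^ code φ ≤ 2 ^ code φ.all := by
      have hlt : code φ < code φ.all := by simpa using body_lt (c := code φ.all) (by simp)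
      rw [← pow_succ']
      exact Nat.pow_le_pow_right two_pos hlt
    have h' := h.mono hφ
    simp only [code_all, tag_pair, body_pair, List.getD_cons_succ, List.getD_cons_zero,
      List.all_eq_true, BoundedFormula.realize_all]
    constructor
    · intro hall x
      obtain ⟨τ, hτ, hcounts⟩ := h'.exists_mem_refinements x
      exact (ih (cells_snoc a x ▸ hcounts)).1 (hall τ hτ)
    · intro hall τ hτ
      obtain ⟨x, -, hcounts⟩ := h'.exists_of_mem_refinements (isPartition_cells a) hτ
      exact (ih (cells_snoc a x ▸ hcounts)).2 (hall x)

end Correctness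

/-! ### The properties of `T₂` -/

section Completeness

theorem truth_code_iff_realize_sentence {A : Type*} [BooleanAlgebra A] [lang.Structure A]
    [FinAlgebra A] (φ : lang.Sentence) : truth [([], ⊤)] (code φ) = true ↔ A ⊨ φ := by
  rw [Sentence.Realize, Formula.Realize, Subsingleton.elim default (default : Empty → A)]
  exact truth_code_iff φ (.cons ⟨rfl, .top_of_not_isFin FinAlgebra.not_isFin_top⟩ .nil)

theorem powerset_models_T₂ (I : Type*) [Infinite I] : Set I ⊨ T₂ :=
  models_T₂_iff.2 inferInstance

theorem T₂_isComplete : T₂.IsComplete := by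
  rw [Theory.IsComplete.isComplete_iff_models_elementarily_equivalent]
  refine ⟨?_, fun M N => elementarilyEquivalent_iff.2 fun φ => ?_⟩
  · have := powerset_models_T₂ ℕ
    exact Theory.Model.isSatisfiable (Set ℕ)
  · obtain ⟨_, _⟩ := exists_finAlgebra M
    obtain ⟨_, _⟩ := exists_finAlgebra N
    rw [← truth_code_iff_realize_sentence, ← truth_code_iff_realize_sentence]

theorem realize_powerset_iff (I : Type*) [Infinite I] (φ : lang.Sentence) :
    Set I ⊨ φ ↔ T₂ ⊨ᵇ φ :=
  have := powerset_models_T₂ I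
  T₂_isComplete.realize_sentence_iff φ (Set I)

theorem T₂_isDecidable : IsDecidable T₂ := by
  have htruth (φ : lang.Sentence) : truth [([], ⊤)] (code φ) = true ↔ T₂ ⊨ᵇ φ :=
    (truth_code_iff_realize_sentence φ).trans (realize_powerset_iff ℕ φ)
  have hdec : PrimrecPred fun m => (formulaValid 0 m && truth [([], ⊤)] m) = true :=
    Primrec.eq.comp (Primrec.and.comp (primrec_formulaValid.comp (.const 0) .id)
      (primrec_truth.comp (.const _) .id)) (.const true)
  refine hdec.computablePred.of_eq fun m => ?_
  rw [Bool.and_eq_true, formulaValid_iff]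
  constructor
  · rintro ⟨⟨φ, rfl⟩, h⟩
    exact ⟨φ, rfl, (htruth φ).1 h⟩
  · rintro ⟨φ, rfl, h⟩
    exact ⟨⟨φ, rfl⟩, (htruth φ).2 h⟩

end Completeness

section QuantifierElimination

universe u v w

theorem isQF_iInf {L : FirstOrder.Language} {α : Type*} {n : ℕ} {β : Type*} [Finite β]
    {f : β → L.BoundedFormula α n} (h : ∀ b, (f b).IsQF) : (BoundedFormula.iInf f).IsQF := by
  have (l : List β) : ((l.map f).foldr (· ⊓ ·) ⊤).IsQF := by
    induction l with
    | nil => exact .top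
    | cons b l ih => exact (h b).inf ih
  exact this _

theorem isQF_iSup {L : FirstOrder.Language} {α : Type*} {n : ℕ} {β : Type*} [Finite β]
    {f : β → L.BoundedFormula α n} (h : ∀ b, (f b).IsQF) : (BoundedFormula.iSup f).IsQF := by
  have (l : List β) : ((l.map f).foldr (· ⊔ ·) ⊥).IsQF := by
    induction l with
    | nil => exact BoundedFormula.isQF_bot
    | cons b l ih => exact (h b).sup ih
  exact this _

theorem exists_isQF_of_determined {L : FirstOrder.Language.{u, v}} {T : L.Theory} {α : Type w}
    (φ : L.Formula α) {ι : Type*} [Finite ι] (θ : ι → L.Formula α) (hθ : ∀ i, (θ i).IsQF)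
    (h : ∀ (M N : Theory.ModelType.{u, v, max u v w} T) (v : α → M) (v' : α → N),
      (∀ i, (θ i).Realize v ↔ (θ i).Realize v') → φ.Realize v → φ.Realize v') :
    ∃ ψ : L.Formula α, BoundedFormula.IsQF ψ ∧ T ⊨ᵇ φ.iff ψ := by
  classical
  -- `ψ` says that the truth values of the `θ i` form a pattern that occurs together with `φ`.
  let S := {p : Set ι // ∃ (M : Theory.ModelType.{u, v, max u v w} T) (v : α → M),
    (∀ i, (θ i).Realize v ↔ i ∈ p) ∧ φ.Realize v}
  let ψ : L.Formula α := BoundedFormula.iSup fun p : S =>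
    BoundedFormula.iInf fun i => if i ∈ p.1 then θ i else (θ i).not
  have hψ (M : Theory.ModelType.{u, v, max u v w} T) (v : α → M) :
      ψ.Realize v ↔ ∃ p : S, ∀ i, (θ i).Realize v ↔ i ∈ p.1 := by
    simp only [ψ, Formula.Realize, BoundedFormula.realize_iSup, BoundedFormula.realize_iInf]
    refine exists_congr fun p => forall_congr' fun i => ?_
    by_cases hi : i ∈ p.1
    · simp [hi]
    · simp only [hi, if_false, iff_false]
      exact Formula.realize_not
  refine ⟨ψ, isQF_iSup fun p => isQF_iInf fun i => ?_, Theory.models_formula_iff.2 fun M v => ?_⟩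
  · split_ifs
    exacts [hθ i, (hθ i).not]
  · rw [Formula.realize_iff, hψ]
    constructor
    · intro hφ
      exact ⟨⟨{i | (θ i).Realize v}, M, v, fun i => Iff.rfl, hφ⟩, fun i => Iff.rfl⟩
    · rintro ⟨⟨p, N, v', hp, hφ⟩, hv⟩
      exact h N M v' v (fun i => (hp i).trans (hv i).symm) hφ

variable {A B : Type*} [BooleanAlgebra A] [lang.Structure A] [BooleanAlgebra B] [lang.Structure B]
  {m : ℕ}

theorem exists_counts_counts {γ : Type*} {f : γ → A} {g : γ → B} {L : Labelled γ}
    (h : ∀ c ∈ L, ∃ r, IsCount m (f c.2) r ∧ IsCount m (g c.2) r) :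
    ∃ σ, Counts m (L.map (Prod.map id f)) σ ∧ Counts m (L.map (Prod.map id g)) σ := by
  induction L with
  | nil => exact ⟨[], .nil, .nil⟩
  | cons c L ih =>
    obtain ⟨⟨r, hf, hg⟩, hL⟩ := List.forall_mem_cons.1 h
    obtain ⟨σ, hσ, hσ'⟩ := ih hL
    exact ⟨(c.1, r) :: σ, .cons ⟨rfl, hf⟩ hσ, .cons ⟨rfl, hg⟩ hσ'⟩

/-- The terms for the cells of the partition generated by the free variables. -/
def cellTerms (n : ℕ) : Labelled (lang.Term (Fin n ⊕ Fin 0)) := cells fun i => .var (.inl i)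

theorem map_realize_cellTerms [IsBooleanStructure A] {n : ℕ} (v : Fin n → A) :
    (cellTerms n).map (Prod.map id (Term.realize (Sum.elim v default))) = cells v :=
  (cells_comp (realize_top _) (realize_inf _) (realize_compl _) _).symm

variable [FinAlgebra A]

theorem exists_isCount_isCount {x : A} {y : B} (hfin : IsFin x ↔ IsFin y)
    (hsize : ∀ k < m, (k.succ : ℕ∞) ≤ size x ↔ (k.succ : ℕ∞) ≤ size y) :
    ∃ r, IsCount m x r ∧ IsCount m y r := by
  obtain ⟨r, hr, -⟩ := IsCount.exists_le_or_eq_top m x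
  refine ⟨r, hr, hfin.symm.trans hr.isFin_iff, Eq.trans ?_ hr.min_size⟩
  refine ENat.eq_of_forall_natCast_le_iff fun k => ?_
  rw [le_min_iff, le_min_iff, Nat.cast_le]
  cases k with
  | zero => simp
  | succ k => exact and_congr_left fun hk => (hsize k hk).symm

theorem T₂_hasQuantifierElimination : HasQuantifierElimination T₂ := by
  intro n φ
  let φ' : lang.BoundedFormula Empty n := BoundedFormula.relabel Sum.inr φ
  let m := 2 ^ code φ'
  let θ : {c // c ∈ cellTerms n} × Option (Fin m) → lang.Formula (Fin n) := fun p =>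
    p.2.elim (finF p.1.1.2) fun k => cF k.1.succPNat p.1.1.2
  have : Finite {c // c ∈ cellTerms n} := (cellTerms n).finite_toSet
  refine exists_isQF_of_determined φ θ (fun p => ?_) fun M N v v' h => ?_
  · rcases p with ⟨c, _ | k⟩ <;> exact (BoundedFormula.IsAtomic.rel _ _).isQF
  obtain ⟨_, _⟩ := exists_finAlgebra M
  obtain ⟨_, _⟩ := exists_finAlgebra N
  obtain ⟨σ, hv, hv'⟩ : ∃ σ, Counts m (cells v) σ ∧ Counts m (cells v') σ := by
    rw [← map_realize_cellTerms, ← map_realize_cellTerms]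
    refine exists_counts_counts fun c hc => exists_isCount_isCount ?_ fun k hk => ?_
    · simpa [θ, Formula.Realize] using h (⟨c, hc⟩, none)
    · simpa [θ, Formula.Realize, FinAlgebra.relMap_C] using h (⟨c, hc⟩, some ⟨k, hk⟩)
  rw [← Formula.realize_relabel_sumInr, ← Formula.realize_relabel_sumInr (x := v')]
  exact ((truth_code_iff φ' hv).symm.trans (truth_code_iff φ' hv')).1

end QuantifierElimination

end BoolFin

theorem theorem2 :
    BoolFin.T₂.IsComplete ∧
    BoolFin.IsDecidable BoolFin.T₂ ∧
    BoolFin.HasQuantifierElimination BoolFin.T₂ ∧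
    ∀ (I : Type*) [Infinite I],
      BoolFin.lang.completeTheory (Set I) = {φ : BoolFin.lang.Sentence | BoolFin.T₂ ⊨ᵇ φ} :=
  ⟨BoolFin.T₂_isComplete, BoolFin.T₂_isDecidable, BoolFin.T₂_hasQuantifierElimination,
    fun I _ => Set.ext fun φ => BoolFin.realize_powerset_iff I φ⟩
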